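/- Let $d\ge 2$ be an integer, $\gamma>0$ and $c=\gamma-d-1$. For a vector field $\vartheta:\mathbb R^d\to\mathbb C^d$ and $0<\beta<1$ put $$\mathcal R_\beta[\vartheta](\eta)=\beta^{c}e^{|\eta|^\gamma(1-\beta^{-\gamma})}\,\vartheta\!\left(\frac{\eta}{\beta}\right)+i\gamma\int_1^{1/\beta}\frac{e^{|\eta|^\gamma(1-t^\gamma)}}{t^{c}}\int_{\mathbb R^d}\bigl(\eta\cdot\vartheta(t\eta-x)\bigr)\,P_\eta\vartheta(x)\,dx\,dt,$$ where $P_\eta v=v-\frac{v\cdot\eta}{|\eta|^2}\eta$. For $\nu\in\mathbb R$ and $p>1$ let $u_\nu(x)=e^{|x|}|x|^\nu$ and $\|f\|_{u_\nu,p}=\left(\int_{\mathbb R^d}|f(x)|^p u_\nu(x)^p\,dx\right)^{1/p}$; let $\mathfrak L^p_{u_\nu}$ be the space of measurable fields $f:\mathbb R^d\to\mathbb C^d\cong\mathbb R^{2d}$ (modulo null sets) of finite norm, and $\mathfrak R^p_{u_\nu}$ its subspace of radial fields, i.e. of fields all of whose components depend only on $|x|$. Suppose that $p>1$, $r>1$,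 $\nu$ and $\kappa$ are real numbers with $$\frac1r=\frac2p+\frac{2\nu+\kappa}{d}-1,\quad \kappa<\frac dr,\quad \frac{d-1}{2}\Bigl(1-\frac2p\Bigr)<\nu<d\,\frac{p-1}{p},\quad 2r\ge p,\quad \max\{\nu,\kappa\}>0,\quad \nu+\kappa\ge(d-1)\Bigl(\frac1r-\frac1p\Bigr),$$ $$\max\{0,\,d+p(c+\nu)\}<\frac{d(r-p)}{r}+p(\nu+\kappa+1)<\frac{\gamma p(r-1)}{r},$$ $$\frac{\gamma p(r-1)}{r}-\frac{d(r-p)}{r}-p(\nu+\kappa+1)>\gamma,\qquad p>\frac{r}{r-1}.$$ Then for every $\beta\in(0,1)$ there is $\widehat A>0$ such that $\mathcal R_\beta$ is a contraction on the convex set $$\widehat{\mathcal E}=\{\vartheta\in\mathfrak R^p_{u_\nu}:\ \|\vartheta\|_{u_\nu,p}\le\widehat A\}.$$ That is, for every $\vartheta\in\widehat{\mathcal E}$ the double integral defining $\mathcal R_\beta[\vartheta](\eta)$ converges absolutely for almost every $\eta$, the field $\mathcal R_\beta[\vartheta]$ (which need not be radial) belongs to $\mathfrak L^p_{u_\nu}$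 and satisfies $|\mathcal R_\beta[\vartheta]|\le|g|$ almost everywhere for some $g\in\widehat{\mathcal E}$, and there is $q<1$ such that $$\|\mathcal R_\beta[\vartheta_1]-\mathcal R_\beta[\vartheta_2]\|_{u_\nu,p}\le q\,\|\vartheta_1-\vartheta_2\|_{u_\nu,p}\qquad\text{for all }\vartheta_1,\vartheta_2\in\widehat{\mathcal E}.$$ In particular, $0$ is the only fixed point of $\mathcal R_\beta$ in $\widehat{\mathcal E}$. -/

import Mathlib

open MeasureTheory

noncomputable section

namespace NSRenorm

/-- The frequency space `ℝ^d` with its Euclidean norm. -/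
abbrev RSpace (d : ℕ) : Type := EuclideanSpace ℝ (Fin d)

/-- The space of values `ℂ^d = ℝ^(2d)` with its Euclidean norm. -/
abbrev CSpace (d : ℕ) : Type := EuclideanSpace ℂ (Fin d)

/-- The (complex bilinear) scalar product `y · v` of a real and a complex vector. -/
def dotRC {d : ℕ} (y : RSpace d) (v : CSpace d) : ℂ := ∑ i, (y i : ℂ) * v i

/-- The Leray projection `P_y v = v - ((v · y) / |y|²) y`. -/
def leray {d : ℕ} (y : RSpace d) (v : CSpace d) : CSpace d :=
  WithLp.toLp 2 fun i => v i - dotRC y v / ((‖y‖ ^ 2 : ℝ) : ℂ) * (y i : ℂ)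

/-- The scaling exponent `c = γ - d - 1`. -/
def scalingExp (d : ℕ) (γ : ℝ) : ℝ := γ - d - 1

/-- The integrand of the nonlinear term:
`e^{|η|^γ (1 - t^γ)} t^{-c} (η · ϑ(tη - x)) P_η ϑ(x)`. -/
def nonlinIntegrand {d : ℕ} (γ : ℝ) (ϑ : RSpace d → CSpace d) (η : RSpace d)
    (t : ℝ) (x : RSpace d) : CSpace d :=
  (Real.exp (‖η‖ ^ γ * (1 - t ^ γ)) / t ^ scalingExp d γ) •
    (dotRC η (ϑ (t • η - x)) • leray η (ϑ x))

/-- The renormalization operator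
`R_β[ϑ](η) = β^c e^{|η|^γ (1 - β^{-γ})} ϑ(η/β)
  + i γ ∫_1^{1/β} e^{|η|^γ (1 - t^γ)} t^{-c} ∫_{ℝ^d} (η · ϑ(tη - x)) P_η ϑ(x) dx dt`. -/
def renorm {d : ℕ} (γ β : ℝ) (ϑ : RSpace d → CSpace d) (η : RSpace d) : CSpace d :=
  (β ^ scalingExp d γ * Real.exp (‖η‖ ^ γ * (1 - 1 / β ^ γ))) • ϑ (β⁻¹ • η) +
    (Complex.I * (γ : ℂ)) • ∫ t in (1 : ℝ)..(1 / β), ∫ x, nonlinIntegrand γ ϑ η t x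

/-- Absolute convergence of the double integral in `R_β[ϑ](η)`. -/
def NonlinConverges {d : ℕ} (γ β : ℝ) (ϑ : RSpace d → CSpace d) (η : RSpace d) : Prop :=
  Integrable (fun z : ℝ × RSpace d => nonlinIntegrand γ ϑ η z.1 z.2)
    ((volume.restrict (Set.Ioc (1 : ℝ) (1 / β))).prod volume)

/-- The weight `u_ν(x) = e^{|x|} |x|^ν`. -/
def weight {d : ℕ} (ν : ℝ) (x : RSpace d) : ℝ := Real.exp ‖x‖ * ‖x‖ ^ ν

/-- The weighted norm `‖f‖_{u_ν,p} = (∫ |f|^p u_ν^p dx)^{1/p}`, with values in `[0, ∞]`. -/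
def wnorm {d : ℕ} (ν p : ℝ) (f : RSpace d → CSpace d) : ENNReal :=
  eLpNorm (fun x => weight ν x • f x) (ENNReal.ofReal p) volume

/-- Membership in the weighted space `𝔏^p_{u_ν} = (L^p_{u_ν}(ℝ^d, ℝ))^{2d}`. -/
def MemL {d : ℕ} (ν p : ℝ) (f : RSpace d → CSpace d) : Prop :=
  AEStronglyMeasurable f volume ∧ wnorm ν p f < ⊤

/-- `f` depends (up to a null set) only on the radial coordinate, i.e. every component of `f`
is a radial function. -/
def IsRadial {d : ℕ} (f : RSpace d → CSpace d) : Prop :=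
  ∃ g : ℝ → CSpace d, Measurable g ∧ ∀ᵐ x : RSpace d, f x = g ‖x‖

/-- The ball `{ϑ ∈ 𝔑^p_{u_ν} : ‖ϑ‖_{u_ν,p} ≤ A}` of the space of radial fields. -/
def radialBall (d : ℕ) (ν p A : ℝ) : Set (RSpace d → CSpace d) :=
  {ϑ | MemL ν p ϑ ∧ IsRadial ϑ ∧ wnorm ν p ϑ ≤ ENNReal.ofReal A}

/-- The set of fields in `𝔏^p_{u_ν}` that are bounded in absolute value by a radial field of
weighted norm at most `A`. -/
def radiallyBoundedBall (d : ℕ) (ν p A : ℝ) : Set (RSpace d → CSpace d) :=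
  {ϑ | MemL ν p ϑ ∧ ∃ g ∈ radialBall d ν p A, ∀ᵐ x : RSpace d, ‖ϑ x‖ ≤ ‖g x‖}

end NSRenorm

end

namespace NSRenorm

open MeasureTheory
open scoped ENNReal

variable {d : ℕ}

/-! ### Integrals of powers of the norm -/

/-! The operator is a linear part plus a quadratic part. If the linear part has norm `b < 1` and the
quadratic part satisfies a bilinear bound in the weighted norm, then the operator contracts every
sufficiently small ball around `0`.

Put `δ = d(1 - 1/p) - ν`. The linear part has norm at most `β ^ (c + ν + d/p)`, and this exponent
equals `γ - 1 - δ`. The scaling relation eliminates `κ` and turns the remaining hypotheses into `γ >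
1 + δ`, `p > 2`, `d(1 - 2/p) < 2ν` and `p(1 + δ) < γ(p - 1)`.

For the bilinear bound (`exists_wpow_majorant_le`) all fields are replaced by their sizes, so that
every integral is taken in `[0, ∞]`. Since `t ≥ 1`, the triangle inequality distributes the factor
`e^{|η|}` over the two arguments of the convolution. Jensen's inequality in `t`, with the
Gaussian-like factor as density, gains `min(1, |η|^{-γ(p-1)})`. What remains is a convolution
inequality with power weights (`exists_conv_le`). The convolution is split according to whether one
argument is small or both are large: the first case uses Jensen and Hölder on balls, the second
Cauchy-Schwarz and Hölder on tails.

The size bound `dominator` is built from norms and convolutions, so it is invariant under isometries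
when the input size is radial. It therefore provides the radial field that dominates the image. -/

lemma nontrivial_RSpace (hd : 2 ≤ d) : Nontrivial (RSpace d) := by
  apply Module.nontrivial_of_finrank_pos (R := ℝ)
  simp; omega

lemma ae_ne_zero (hd : 2 ≤ d) : ∀ᵐ x : RSpace d, x ≠ 0 := by
  have := nontrivial_RSpace hd
  exact Measure.ae_ne volume 0

lemma lintegral_comp_smul (f : RSpace d → ℝ≥0∞) {r : ℝ} (hr : 0 < r) :
    ∫⁻ x, f (r • x) = ENNReal.ofReal r ^ (-(d : ℝ)) * ∫⁻ x, f x := by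
  have he : MeasurableEmbedding (fun x : RSpace d => r • x) :=
    (Homeomorph.smul (isUnit_iff_ne_zero.2 hr.ne').unit).measurableEmbedding
  have h := he.lintegral_map (μ := volume) f
  rw [← h, Measure.map_addHaar_smul _ hr.ne', lintegral_smul_measure, smul_eq_mul,
    finrank_euclideanSpace_fin, abs_of_pos (by positivity), ENNReal.ofReal_inv_of_pos (by positivity),
    ENNReal.rpow_neg, ENNReal.rpow_natCast, ENNReal.ofReal_pow hr.le]

lemma enorm_ne_zero_of_ne {x : RSpace d} (hx : x ≠ 0) : ‖x‖ₑ ≠ 0 := by simpa using hx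

/-- Homogeneity of the integrals of powers of the norm. -/
lemma setLIntegral_enorm_rpow_scale (s : ℝ) {S : Set (RSpace d)} (hS : MeasurableSet S)
    {y : RSpace d} (hy : y ≠ 0) :
    ∫⁻ x in {x | ‖y‖⁻¹ • x ∈ S}, ‖x‖ₑ ^ s =
      ‖y‖ₑ ^ (d + s) * ∫⁻ x in S, ‖x‖ₑ ^ s := by
  have hy0 : 0 < ‖y‖ := norm_pos_iff.2 hy
  have hyi : 0 < ‖y‖⁻¹ := by positivity
  have hS' : MeasurableSet {x : RSpace d | ‖y‖⁻¹ • x ∈ S} := (measurable_const_smul ‖y‖⁻¹) hS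
  have h := lintegral_comp_smul (S.indicator fun x : RSpace d => ‖x‖ₑ ^ s) hyi
  have e : ENNReal.ofReal ‖y‖⁻¹ = ‖y‖ₑ⁻¹ := by
    rw [ENNReal.ofReal_inv_of_pos hy0, ofReal_norm]
  rw [lintegral_indicator hS, e, ENNReal.inv_rpow, ENNReal.rpow_neg, inv_inv] at h
  rw [ENNReal.rpow_add _ _ (enorm_ne_zero_of_ne hy) enorm_ne_top, mul_comm (_ ^ _), mul_assoc, ← h,
    ← lintegral_const_mul' _ _ (by simp [ENNReal.rpow_eq_top_iff, hy]), ← lintegral_indicator hS']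
  refine lintegral_congr fun x => ?_
  by_cases hx : ‖y‖⁻¹ • x ∈ S
  · rw [Set.indicator_of_mem (show x ∈ {x | ‖y‖⁻¹ • x ∈ S} from hx), Set.indicator_of_mem hx,
      enorm_smul]
    have e2 : ‖(‖y‖⁻¹ : ℝ)‖ₑ = ‖y‖ₑ⁻¹ := by
      rw [← e, Real.enorm_eq_ofReal hyi.le]
    rw [e2]
    have hA : ‖y‖ₑ ^ s ≠ 0 := by simp [ENNReal.rpow_eq_zero_iff, hy]
    have hB : ‖y‖ₑ ^ s ≠ ∞ := by simp [ENNReal.rpow_eq_top_iff, hy]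
    rw [ENNReal.mul_rpow_of_ne_top (by simp [hy]) enorm_ne_top, ENNReal.inv_rpow, ← mul_assoc,
      ENNReal.mul_inv_cancel hA hB, one_mul]
  · rw [Set.indicator_of_notMem (show x ∉ {x | ‖y‖⁻¹ • x ∈ S} from hx),
      Set.indicator_of_notMem hx, mul_zero]

lemma setLIntegral_unitBall_enorm_rpow_lt_top (hd : 2 ≤ d) {s : ℝ} (hs : -(d : ℝ) < s) :
    ∫⁻ x in {x : RSpace d | ‖x‖ ≤ 1}, ‖x‖ₑ ^ s < ∞ := by
  have h := integrableOn_ball_of_norm_le_rpow (μ := (volume : Measure (RSpace d)))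
    (f := fun x => ‖x‖ ^ s) (C := 1) (α := -s) (r := 2) (by simp; omega)
    (by simp; linarith)
    (by filter_upwards with x; simp [abs_of_nonneg (Real.rpow_nonneg (norm_nonneg x) s)])
    (measurable_norm.pow_const s).aestronglyMeasurable
  refine lt_of_le_of_lt ?_ h.2
  rw [← lintegral_indicator (by measurability), ← lintegral_indicator (by measurability)]
  -- The origin is discarded: for negative `s` the real power `0 ^ s` is `0`, while the extended one
  -- is `∞`.
  refine lintegral_mono_ae ?_
  filter_upwards [ae_ne_zero hd] with x hx
  refine Set.indicator_apply_le fun h1 => ?_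
  rw [Set.indicator_of_mem (by simp at h1 ⊢; linarith), Real.enorm_eq_ofReal (by positivity),
    ← ENNReal.ofReal_rpow_of_pos (norm_pos_iff.2 hx), ofReal_norm]

lemma setLIntegral_tail_enorm_rpow_lt_top {s : ℝ} (hs : s < -(d : ℝ)) :
    ∫⁻ x in {x : RSpace d | 1 ≤ 2 * ‖x‖}, ‖x‖ₑ ^ s < ∞ := by
  have h := finite_integral_one_add_norm (E := RSpace d) (μ := volume) (r := -s) (by simp; linarith)
  -- On the region `1 ≤ 2‖x‖` one has `1 + ‖x‖ ≤ 3‖x‖`, which the negative power `s` reverses.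
  have h2 : ENNReal.ofReal (3 ^ (-s)) *
    ∫⁻ x : RSpace d, ENNReal.ofReal ((1 + ‖x‖) ^ s) < ∞ :=
    ENNReal.mul_lt_top ENNReal.ofReal_lt_top (by simpa using h)
  refine lt_of_le_of_lt ?_ h2
  rw [← lintegral_indicator (measurableSet_le (by fun_prop) (by fun_prop)),
    ← lintegral_const_mul' _ _ ENNReal.ofReal_ne_top]
  refine lintegral_mono_ae ?_
  filter_upwards with x
  refine Set.indicator_apply_le' (fun h1 => ?_) fun _ => zero_le
  simp only [Set.mem_ofPred_eq] at h1
  have hx : 0 < ‖x‖ := by linarith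
  rw [← ENNReal.ofReal_mul (by positivity), ← ofReal_norm, ENNReal.ofReal_rpow_of_pos hx]
  apply ENNReal.ofReal_le_ofReal
  rw [Real.rpow_neg (by norm_num), ← div_eq_inv_mul, ← Real.div_rpow (by positivity) (by norm_num)]
  apply Real.rpow_le_rpow_of_nonpos (by positivity) (by linarith)
  linarith [(Nat.cast_nonneg d : (0 : ℝ) ≤ d)]

lemma exists_ball_bound (hd : 2 ≤ d) {s : ℝ} (hs : -(d : ℝ) < s) :
    ∃ C : ℝ≥0∞, C ≠ ∞ ∧ ∀ y : RSpace d, y ≠ 0 →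
      ∫⁻ x in {x : RSpace d | ‖x‖ ≤ ‖y‖}, ‖x‖ₑ ^ s ≤ ‖y‖ₑ ^ (d + s) * C := by
  refine ⟨_, (setLIntegral_unitBall_enorm_rpow_lt_top hd hs).ne, fun y hy => ?_⟩
  rw [← setLIntegral_enorm_rpow_scale s (measurableSet_le (by fun_prop) (by fun_prop)) hy]
  refine lintegral_mono_set fun x hx => ?_
  have hy0 : 0 < ‖y‖ := norm_pos_iff.2 hy
  simp only [Set.mem_ofPred_eq] at hx ⊢
  rw [norm_smul, norm_inv, norm_norm, inv_mul_le_iff₀ hy0]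
  linarith

lemma exists_tail_bound {s : ℝ} (hs : s < -(d : ℝ)) :
    ∃ C : ℝ≥0∞, C ≠ ∞ ∧ ∀ y : RSpace d, y ≠ 0 →
      ∫⁻ x in {x : RSpace d | ‖y‖ ≤ 2 * ‖x‖}, ‖x‖ₑ ^ s ≤ ‖y‖ₑ ^ (d + s) * C := by
  refine ⟨_, (setLIntegral_tail_enorm_rpow_lt_top (d := d) hs).ne, fun y hy => ?_⟩
  rw [← setLIntegral_enorm_rpow_scale s (measurableSet_le (by fun_prop) (by fun_prop)) hy]
  refine lintegral_mono_set fun x hx => ?_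
  have hy0 : 0 < ‖y‖ := norm_pos_iff.2 hy
  simp only [Set.mem_ofPred_eq] at hx ⊢
  rw [norm_smul, norm_inv, norm_norm, ← mul_assoc, mul_comm 2, mul_assoc, ← div_eq_inv_mul, one_le_div hy0]
  linarith

/-- The condition `0 < θ` gives convergence at the origin and `θ < σ` at infinity. With `θ = p(1 +
δ)` this is the integral left over when both arguments of the convolution are large. -/
lemma lintegral_enorm_rpow_mul_min_lt_top (hd : 2 ≤ d) {θ σ : ℝ} (hθ : 0 < θ) (hσ : θ < σ) :
    ∫⁻ x : RSpace d, ‖x‖ₑ ^ (θ - d) * min 1 (‖x‖ₑ ^ (-σ)) < ∞ := by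
  have h1 := setLIntegral_unitBall_enorm_rpow_lt_top hd (s := θ - d) (by linarith)
  have h2 := setLIntegral_tail_enorm_rpow_lt_top (d := d) (s := θ - d - σ) (by linarith)
  refine lt_of_le_of_lt ?_ (ENNReal.add_lt_top.2 ⟨h1, h2⟩)
  rw [← lintegral_indicator (measurableSet_le (by fun_prop) (by fun_prop)),
    ← lintegral_indicator (measurableSet_le (by fun_prop) (by fun_prop)),
    ← lintegral_add_left ((Measurable.pow_const (by fun_prop) _).indicator
      (measurableSet_le (by fun_prop) (by fun_prop)))]
  refine lintegral_mono_ae ?_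
  filter_upwards [ae_ne_zero hd] with x hx
  rcases le_or_gt ‖x‖ 1 with h | h
  · refine le_add_right ?_
    rw [Set.indicator_of_mem (by simpa using h)]
    exact mul_le_of_le_one_right' (min_le_left _ _)
  · refine le_add_left ?_
    rw [Set.indicator_of_mem (by simp; linarith), sub_eq_add_neg (θ - d),
      ENNReal.rpow_add _ _ (enorm_ne_zero_of_ne hx) enorm_ne_top]
    gcongr
    exact min_le_right _ _

/-! ### The weighted convolution inequality -/

/-- The `p`-th power of the `L^p` norm with the power weight `|x|^ν`. -/
noncomputable def powNorm (ν p : ℝ) (F : RSpace d → ℝ≥0∞) : ℝ≥0∞ := ∫⁻ x, (‖x‖ₑ ^ ν * F x) ^ p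

/-- The weight `|x|^e min(1, |x|^{-σ})`. -/
noncomputable def cutWeight (e σ : ℝ) (x : RSpace d) : ℝ≥0∞ := ‖x‖ₑ ^ e * min 1 (‖x‖ₑ ^ (-σ))

lemma measurable_cutWeight (e σ : ℝ) : Measurable (cutWeight (d := d) e σ) := by
  unfold cutWeight
  fun_prop

lemma enorm_le_ofReal_mul {a : ℝ} {y z : RSpace d} (h : ‖y‖ ≤ a * ‖z‖) :
    ‖y‖ₑ ≤ ENNReal.ofReal a * ‖z‖ₑ := by
  rw [← ofReal_norm, ← ofReal_norm, ← ENNReal.ofReal_mul' (norm_nonneg z)]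
  exact ENNReal.ofReal_le_ofReal h

/-- Both factors of the weight are stable between points of comparable norm. It serves with `a = 2`
to move the weight from `y` to `y - x`, and with `a = 1 / β` to move it from `η` to `t • η`. -/
lemma cutWeight_le {e σ : ℝ} (he : 0 ≤ e) (hσ : 0 ≤ σ) {a : ℝ≥0∞} (ha : 1 ≤ a) (ha' : a ≠ ∞)
    {y z : RSpace d} (h1 : ‖y‖ₑ ≤ a * ‖z‖ₑ) (h2 : ‖z‖ₑ ≤ a * ‖y‖ₑ) :
    cutWeight e σ y ≤ a ^ (e + σ) * cutWeight e σ z := by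
  have ha0 : a ≠ 0 := (lt_of_lt_of_le zero_lt_one ha).ne'
  have hE : ‖y‖ₑ ^ e ≤ a ^ e * ‖z‖ₑ ^ e := by
    rw [← ENNReal.mul_rpow_of_nonneg _ _ he]
    exact ENNReal.rpow_le_rpow h1 he
  have hS : ‖y‖ₑ ^ (-σ) ≤ a ^ σ * ‖z‖ₑ ^ (-σ) := by
    have h3 : ‖z‖ₑ ^ σ ≤ a ^ σ * ‖y‖ₑ ^ σ := by
      rw [← ENNReal.mul_rpow_of_nonneg _ _ hσ]
      exact ENNReal.rpow_le_rpow h2 hσ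
    have hA : a ^ σ ≠ 0 := by simp [ENNReal.rpow_eq_zero_iff, ha0, ha']
    have hB : a ^ σ ≠ ∞ := by simp [ENNReal.rpow_eq_top_iff, ha0, ha']
    rw [ENNReal.rpow_neg, ENNReal.rpow_neg, ← div_eq_mul_inv]
    rw [ENNReal.le_div_iff_mul_le (Or.inr hA) (Or.inr hB)]
    calc (‖y‖ₑ ^ σ)⁻¹ * ‖z‖ₑ ^ σ ≤ (‖y‖ₑ ^ σ)⁻¹ * (a ^ σ * ‖y‖ₑ ^ σ) := by gcongr
      _ = a ^ σ * ((‖y‖ₑ ^ σ)⁻¹ * ‖y‖ₑ ^ σ) := by ring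
      _ ≤ a ^ σ * 1 := by gcongr; exact ENNReal.inv_mul_le_one _
      _ = a ^ σ := mul_one _
  have h1a : 1 ≤ a ^ σ := by simpa using ENNReal.rpow_le_rpow ha hσ
  have hM : min 1 (‖y‖ₑ ^ (-σ)) ≤ a ^ σ * min 1 (‖z‖ₑ ^ (-σ)) := by
    rw [mul_min, mul_one]
    exact min_le_min h1a hS
  calc cutWeight e σ y ≤ (a ^ e * ‖z‖ₑ ^ e) * (a ^ σ * min 1 (‖z‖ₑ ^ (-σ))) := by
        unfold cutWeight; gcongr
    _ = _ := by
      rw [ENNReal.rpow_add _ _ ha0 ha', cutWeight]; ring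

lemma cutWeight_le_one {e σ : ℝ} (he : 0 ≤ e) (hσ : e ≤ σ) {x : RSpace d} (hx : x ≠ 0) :
    cutWeight e σ x ≤ 1 := by
  rw [cutWeight]
  rcases le_total ‖x‖ₑ 1 with h | h
  · exact mul_le_one' (ENNReal.rpow_le_one h he) (min_le_left _ _)
  · calc _ ≤ ‖x‖ₑ ^ e * ‖x‖ₑ ^ (-σ) := by gcongr; exact min_le_right _ _
      _ = ‖x‖ₑ ^ (e - σ) := by
        rw [← ENNReal.rpow_add _ _ (enorm_ne_zero_of_ne hx) enorm_ne_top, sub_eq_add_neg]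
      _ ≤ ‖x‖ₑ ^ (0 : ℝ) := ENNReal.rpow_le_rpow_of_exponent_le h (by linarith)
      _ = 1 := ENNReal.rpow_zero

lemma rpow_mul_cutWeight (a e σ : ℝ) {x : RSpace d} (hx : x ≠ 0) :
    ‖x‖ₑ ^ a * cutWeight e σ x = cutWeight (a + e) σ x := by
  rw [cutWeight, cutWeight, ENNReal.rpow_add _ _ (enorm_ne_zero_of_ne hx) enorm_ne_top, mul_assoc]

/-- Hölder's inequality against the power weight. -/
lemma setLIntegral_rpow_le (hd : 2 ≤ d) {ν p m : ℝ} (hm : 0 < m) (hp : m < p)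
    {F : RSpace d → ℝ≥0∞} (hF : Measurable F) (S : Set (RSpace d)) :
    ∫⁻ x in S, F x ^ m ≤
      powNorm ν p F ^ (m / p) * (∫⁻ x in S, ‖x‖ₑ ^ (-(ν * m / (1 - m / p)))) ^ (1 - m / p) := by
  have hp0 : 0 < p := hm.trans hp
  have hlt : m / p < 1 := (div_lt_one hp0).2 hp
  have hne : 1 - m / p ≠ 0 := by linarith
  -- The exponents are `p / m` and its conjugate; the second function is chosen so that its power
  -- cancels `‖x‖ ^ (ν * m)`.
  have h := ENNReal.lintegral_mul_norm_pow_le (μ := volume.restrict S)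
    (f := fun x => (‖x‖ₑ ^ ν * F x) ^ p) (g := fun x => ‖x‖ₑ ^ (-(ν * m / (1 - m / p))))
    (by fun_prop) (by fun_prop) (p := m / p) (q := 1 - m / p) (by positivity) (by linarith)
    (by ring)
  refine le_trans (lintegral_mono_ae ?_) (h.trans ?_)
  · filter_upwards [ae_restrict_of_ae (ae_ne_zero hd)] with x hx
    rw [← ENNReal.rpow_mul, ← ENNReal.rpow_mul, mul_div_cancel₀ _ hp0.ne', neg_mul,
      div_mul_cancel₀ _ hne, ENNReal.mul_rpow_of_nonneg _ _ hm.le, ← ENNReal.rpow_mul,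
      ENNReal.rpow_neg]
    have hA : ‖x‖ₑ ^ (ν * m) ≠ 0 := by simp [ENNReal.rpow_eq_zero_iff, hx]
    have hB : ‖x‖ₑ ^ (ν * m) ≠ ∞ := by simp [ENNReal.rpow_eq_top_iff, hx]
    rw [mul_comm (‖x‖ₑ ^ (ν * m)), mul_assoc, ENNReal.mul_inv_cancel hA hB, mul_one]
  · gcongr
    exact setLIntegral_le_lintegral _ _

/-- Hölder leaves the integral of `|x|^{-νp/(p-1)}`, whose convergence at the origin is the upper
bound on `ν`. Homogeneity then produces the power `δ` of `‖y‖`. -/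
lemma exists_ball_lintegral_le (hd : 2 ≤ d) {ν p : ℝ} (hp : 1 < p) (hν : ν < d * (1 - 1 / p)) :
    ∃ C : ℝ≥0∞, C ≠ ∞ ∧ ∀ F : RSpace d → ℝ≥0∞, Measurable F → ∀ y : RSpace d, y ≠ 0 →
      ∫⁻ x in {x | ‖x‖ ≤ ‖y‖}, F x ≤
        C * ‖y‖ₑ ^ (d * (1 - 1 / p) - ν) * powNorm ν p F ^ (1 / p) := by
  have hlt : 1 / p < 1 := (div_lt_one (by linarith)).2 hp
  have hpos : 0 < 1 - 1 / p := by linarith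
  obtain ⟨C, hC, h⟩ := exists_ball_bound hd (s := -(ν * 1 / (1 - 1 / p))) (by
    rw [neg_lt_neg_iff, mul_one, div_lt_iff₀ hpos]; exact hν)
  refine ⟨C ^ (1 - 1 / p), ENNReal.rpow_ne_top_of_nonneg hpos.le hC, fun F hF y hy => ?_⟩
  have h1 := setLIntegral_rpow_le hd (ν := ν) one_pos hp hF {x | ‖x‖ ≤ ‖y‖}
  simp only [ENNReal.rpow_one] at h1
  refine h1.trans ?_
  rw [mul_comm]
  gcongr
  refine (ENNReal.rpow_le_rpow (h y hy) hpos.le).trans_eq ?_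
  rw [ENNReal.mul_rpow_of_nonneg _ _ hpos.le, ← ENNReal.rpow_mul, mul_comm]
  congr 2
  have : p - 1 ≠ 0 := by linarith
  field_simp
  ring

/-- Hölder with exponent `p / 2` is available because `p > 2`; the lower bound on `ν` makes the
remaining power integrable at infinity. -/
lemma exists_tail_lintegral_sq_le (hd : 2 ≤ d) {ν p : ℝ} (hp : 2 < p)
    (hν : d * (1 - 2 / p) < 2 * ν) :
    ∃ C : ℝ≥0∞, C ≠ ∞ ∧ ∀ F : RSpace d → ℝ≥0∞, Measurable F → ∀ y : RSpace d, y ≠ 0 →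
      ∫⁻ x in {x | ‖y‖ ≤ 2 * ‖x‖}, F x ^ (2 : ℝ) ≤
        C * ‖y‖ₑ ^ (d * (1 - 2 / p) - 2 * ν) * powNorm ν p F ^ (2 / p) := by
  have hlt : 2 / p < 1 := (div_lt_one (by linarith)).2 hp
  have hpos : 0 < 1 - 2 / p := by linarith
  obtain ⟨C, hC, h⟩ := exists_tail_bound (d := d) (s := -(ν * 2 / (1 - 2 / p))) (by
    rw [neg_lt_neg_iff, lt_div_iff₀ hpos]; linarith)
  refine ⟨C ^ (1 - 2 / p), ENNReal.rpow_ne_top_of_nonneg hpos.le hC, fun F hF y hy => ?_⟩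
  refine (setLIntegral_rpow_le hd (ν := ν) two_pos hp hF {x | ‖y‖ ≤ 2 * ‖x‖}).trans ?_
  rw [mul_comm]
  gcongr
  refine (ENNReal.rpow_le_rpow (h y hy) hpos.le).trans_eq ?_
  rw [ENNReal.mul_rpow_of_nonneg _ _ hpos.le, ← ENNReal.rpow_mul, mul_comm]
  congr 2
  have : p - 2 ≠ 0 := by linarith
  field_simp
  ring

/-- Jensen's inequality with the density `G`. -/
lemma lintegral_mul_rpow_le {α : Type*} [MeasurableSpace α] {μ : Measure α} {p : ℝ} (hp : 1 < p)
    {G φ : α → ℝ≥0∞} (hG : AEMeasurable G μ) (hφ : AEMeasurable φ μ) :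
    (∫⁻ x, G x * φ x ∂μ) ^ p ≤ (∫⁻ x, G x ∂μ) ^ (p - 1) * ∫⁻ x, G x * φ x ^ p ∂μ := by
  have hp0 : 0 < p := by linarith
  have hlt : 1 / p < 1 := (div_lt_one (by linarith)).2 hp
  -- Hölder applied to the splitting `G φ = G^{1 - 1/p} (G φ^p)^{1/p}`; no normalization of `G` is
  -- needed.
  have h := ENNReal.lintegral_mul_norm_pow_le (μ := μ) (f := G) (g := fun x => G x * φ x ^ p)
    hG (by fun_prop) (p := 1 - 1 / p) (q := 1 / p) (by linarith) (by positivity) (by ring)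
  have e : ∀ x, G x ^ (1 - 1 / p) * (G x * φ x ^ p) ^ (1 / p) = G x * φ x := by
    intro x
    rw [ENNReal.mul_rpow_of_nonneg _ _ (by positivity), ← ENNReal.rpow_mul, ← mul_assoc,
      ← ENNReal.rpow_add_of_nonneg _ _ (by linarith) (by positivity), sub_add_cancel,
      ENNReal.rpow_one, mul_one_div_cancel hp0.ne', ENNReal.rpow_one]
  simp only [e] at h
  refine (ENNReal.rpow_le_rpow h hp0.le).trans_eq ?_
  rw [ENNReal.mul_rpow_of_nonneg _ _ hp0.le, ← ENNReal.rpow_mul, ← ENNReal.rpow_mul,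
    one_div_mul_cancel hp0.ne', ENNReal.rpow_one]
  congr 2
  field_simp

/-- The part of the convolution of `F` and `G` where the argument of `G` is small. -/
noncomputable def nearConv (F G : RSpace d → ℝ≥0∞) (y : RSpace d) : ℝ≥0∞ :=
  ∫⁻ x in {x | 2 * ‖x‖ ≤ ‖y‖}, G x * F (y - x)

/-- The part of the convolution of `F` and `G` where both arguments are large. -/
noncomputable def farConv (F G : RSpace d → ℝ≥0∞) (y : RSpace d) : ℝ≥0∞ :=
  ∫⁻ x in {x | ‖y‖ ≤ 2 * ‖x‖ ∧ ‖y‖ ≤ 2 * ‖y - x‖}, F (y - x) * G x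

/-- Jensen with density `G` costs `p - 1` factors of the ball integral of `G`, each of order `‖y‖ ^
δ`. Exchanging the integrals costs one more such factor. The total power is `pν + p(1 + δ)`, and the
cutoff `σ ≥ p(1 + δ)` absorbs the excess over `pν`. -/
lemma exists_nearConv_le (hd : 2 ≤ d) {ν p σ : ℝ} (hp : 1 < p) (hν0 : 0 ≤ ν)
    (hν : ν < d * (1 - 1 / p)) (hσ : p * (1 + (d * (1 - 1 / p) - ν)) ≤ σ) :
    ∃ C : ℝ≥0∞, C ≠ ∞ ∧ ∀ F G : RSpace d → ℝ≥0∞, Measurable F → Measurable G →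
      ∫⁻ y, cutWeight (p * (1 + ν)) σ y * nearConv F G y ^ p ≤
        C * (powNorm ν p F * powNorm ν p G) := by
  obtain ⟨C, hC, hb⟩ := exists_ball_lintegral_le hd hp hν
  set δ : ℝ := d * (1 - 1 / p) - ν with hδ
  have hδ0 : 0 < δ := by linarith
  have hp0 : 0 < p := by linarith
  have hp1 : 0 < p - 1 := by linarith
  -- The weight exponent after absorbing the `p - 1` ball factors that come from Jensen.
  set e : ℝ := δ * (p - 1) + p * (1 + ν) with he
  have he0 : 0 ≤ e := by positivity
  have hσ0 : 0 ≤ σ := le_trans (by positivity) hσ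
  refine ⟨C ^ (p - 1) * 2 ^ (e + σ) * C, ?_, fun F G hF hG => ?_⟩
  · exact ENNReal.mul_ne_top (ENNReal.mul_ne_top (ENNReal.rpow_ne_top_of_nonneg hp1.le hC)
      (ENNReal.rpow_ne_top_of_nonneg (by positivity) (by simp))) hC
  set N := powNorm ν p G ^ (1 / p) with hN
  -- The smallness of `x` is recorded relative to `y - x`, so that after substituting `z = y - x`
  -- the inner integral of `G` runs over the ball of radius `‖z‖`.
  have key : ∀ y : RSpace d, y ≠ 0 → cutWeight (p * (1 + ν)) σ y * nearConv F G y ^ p ≤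
      (C ^ (p - 1) * N ^ (p - 1) * 2 ^ (e + σ)) *
        ∫⁻ x, ({x : RSpace d | ‖x‖ ≤ ‖y - x‖}.indicator G x) *
          (cutWeight e σ (y - x) * F (y - x) ^ p) := by
    intro y hy
    have h1 : nearConv F G y ^ p ≤ (C * ‖y‖ₑ ^ δ * N) ^ (p - 1) *
        ∫⁻ x in {x | 2 * ‖x‖ ≤ ‖y‖}, G x * F (y - x) ^ p := by
      refine (lintegral_mul_rpow_le hp (by fun_prop) (by fun_prop)).trans ?_
      gcongr
      refine le_trans (lintegral_mono_set fun x hx => ?_) (hb G hG y hy)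
      simp only [Set.mem_ofPred_eq] at hx ⊢
      linarith [norm_nonneg x]
    have hmeas : MeasurableSet {x : RSpace d | 2 * ‖x‖ ≤ ‖y‖} :=
      measurableSet_le (by fun_prop) (by fun_prop)
    calc _ ≤ cutWeight (p * (1 + ν)) σ y * ((C * ‖y‖ₑ ^ δ * N) ^ (p - 1) *
        ∫⁻ x in {x | 2 * ‖x‖ ≤ ‖y‖}, G x * F (y - x) ^ p) := by gcongr
      _ = (C ^ (p - 1) * N ^ (p - 1)) * (cutWeight e σ y *
          ∫⁻ x in {x | 2 * ‖x‖ ≤ ‖y‖}, G x * F (y - x) ^ p) := by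
        rw [ENNReal.mul_rpow_of_nonneg _ _ hp1.le, ENNReal.mul_rpow_of_nonneg _ _ hp1.le,
          ← ENNReal.rpow_mul, he, ← rpow_mul_cutWeight _ _ _ hy]
        ring
      _ ≤ (C ^ (p - 1) * N ^ (p - 1)) * (2 ^ (e + σ) *
          ∫⁻ x, ({x : RSpace d | ‖x‖ ≤ ‖y - x‖}.indicator G x) *
          (cutWeight e σ (y - x) * F (y - x) ^ p)) := by
        refine mul_le_mul' le_rfl ?_
        rw [← lintegral_indicator hmeas, ← lintegral_const_mul', ← lintegral_const_mul']
        · refine lintegral_mono_ae ?_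
          filter_upwards with x
          by_cases hx : x ∈ {x : RSpace d | 2 * ‖x‖ ≤ ‖y‖}
          · have hx' : 2 * ‖x‖ ≤ ‖y‖ := hx
            have t1 := norm_sub_norm_le y x
            have t2 := norm_sub_le y x
            have hx2 : x ∈ {x : RSpace d | ‖x‖ ≤ ‖y - x‖} := by
              simp only [Set.mem_ofPred_eq]; linarith
            rw [Set.indicator_of_mem hx, Set.indicator_of_mem hx2]
            have hw : cutWeight e σ y ≤ 2 ^ (e + σ) * cutWeight e σ (y - x) := by
              refine cutWeight_le he0 hσ0 (by norm_num) (by simp) ?_ ?_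
              · simpa using enorm_le_ofReal_mul (a := 2) (y := y) (z := y - x) (by linarith)
              · simpa using enorm_le_ofReal_mul (a := 2) (y := y - x) (z := y) (by linarith)
            calc _ ≤ 2 ^ (e + σ) * cutWeight e σ (y - x) * (G x * F (y - x) ^ p) := by gcongr
              _ = _ := by ring
          · rw [Set.indicator_of_notMem hx, mul_zero]
            exact zero_le
        · exact ENNReal.rpow_ne_top_of_nonneg (by positivity) (by simp)
        · refine (lt_of_le_of_lt (mul_le_mul' le_rfl (min_le_left _ _)) ?_).ne
          rw [mul_one]
          exact ENNReal.rpow_lt_top_of_nonneg he0 enorm_ne_top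
      _ = _ := by ring
  have hS2 : MeasurableSet {q : RSpace d × RSpace d | ‖q.2‖ ≤ ‖q.1‖} :=
    measurableSet_le (by fun_prop) (by fun_prop)
  have mcw := measurable_cutWeight (d := d) e σ
  calc _ ≤ ∫⁻ y, (C ^ (p - 1) * N ^ (p - 1) * 2 ^ (e + σ)) *
        ∫⁻ x, ({x : RSpace d | ‖x‖ ≤ ‖y - x‖}.indicator G x) *
          (cutWeight e σ (y - x) * F (y - x) ^ p) := by
        refine lintegral_mono_ae ?_
        filter_upwards [ae_ne_zero hd] with y hy using key y hy
    _ = (C ^ (p - 1) * N ^ (p - 1) * 2 ^ (e + σ)) * ∫⁻ y,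
        ∫⁻ x, ({x : RSpace d | ‖x‖ ≤ ‖y - x‖}.indicator G x) *
          (cutWeight e σ (y - x) * F (y - x) ^ p) := by
        have : Measurable fun q : RSpace d × RSpace d =>
            ({x : RSpace d | ‖x‖ ≤ ‖q.1 - x‖}.indicator G q.2) *
              (cutWeight e σ (q.1 - q.2) * F (q.1 - q.2) ^ p) := by
          have h1 : Measurable fun q : RSpace d × RSpace d =>
              {x : RSpace d | ‖x‖ ≤ ‖q.1 - x‖}.indicator G q.2 := by
            have : MeasurableSet {q : RSpace d × RSpace d | ‖q.2‖ ≤ ‖q.1 - q.2‖} :=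
              measurableSet_le (by fun_prop) (by fun_prop)
            exact (hG.comp measurable_snd).indicator this
          fun_prop
        rw [lintegral_const_mul]
        exact this.lintegral_prod_right'
    _ = (C ^ (p - 1) * N ^ (p - 1) * 2 ^ (e + σ)) * ∫⁻ z, (cutWeight e σ z * F z ^ p) *
        ∫⁻ x in {x : RSpace d | ‖x‖ ≤ ‖z‖}, G x := by
        congr 1
        have mS : Measurable fun q : RSpace d × RSpace d =>
            {x : RSpace d | ‖x‖ ≤ ‖q.1‖}.indicator G q.2 :=
          (hG.comp measurable_snd).indicator hS2
        have mS' : Measurable fun q : RSpace d × RSpace d =>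
            {x : RSpace d | ‖x‖ ≤ ‖q.1 - x‖}.indicator G q.2 :=
          (hG.comp measurable_snd).indicator
            (measurableSet_le (f := fun q : RSpace d × RSpace d => ‖q.2‖)
              (g := fun q => ‖q.1 - q.2‖) (by fun_prop) (by fun_prop))
        rw [lintegral_lintegral_swap (Measurable.aemeasurable (mS'.mul (by fun_prop)))]
        have e3 : ∀ x : RSpace d, ∫⁻ y : RSpace d, ({x : RSpace d | ‖x‖ ≤ ‖y - x‖}.indicator G x) *
            (cutWeight e σ (y - x) * F (y - x) ^ p) = ∫⁻ z : RSpace d,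
              ({x : RSpace d | ‖x‖ ≤ ‖z‖}.indicator G x) * (cutWeight e σ z * F z ^ p) := by
          intro x
          rw [← lintegral_sub_right_eq_self (fun z : RSpace d =>
            ({x : RSpace d | ‖x‖ ≤ ‖z‖}.indicator G x) * (cutWeight e σ z * F z ^ p)) x]
          rfl
        simp only [e3]
        rw [← lintegral_lintegral_swap (Measurable.aemeasurable (mS.mul (by fun_prop)))]
        refine lintegral_congr fun z => ?_
        rw [lintegral_mul_const _ (hG.indicator (measurableSet_le (by fun_prop) (by fun_prop))),
          lintegral_indicator (measurableSet_le (by fun_prop) (by fun_prop)), mul_comm]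
    _ ≤ (C ^ (p - 1) * N ^ (p - 1) * 2 ^ (e + σ)) * ∫⁻ z, C * N * (‖z‖ₑ ^ ν * F z) ^ p := by
        refine mul_le_mul' le_rfl ?_
        refine lintegral_mono_ae ?_
        filter_upwards [ae_ne_zero hd] with z hz
        have h2 := hb G hG z hz
        -- The last ball factor raises the exponent to `νp + p(1 + δ)`; the part `p(1 + δ) ≤ σ` is
        -- cut off.
        have h3 : cutWeight e σ z * ‖z‖ₑ ^ δ ≤ (‖z‖ₑ ^ ν) ^ p := by
          rw [mul_comm, rpow_mul_cutWeight _ _ _ hz,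
            show δ + e = ν * p + p * (1 + δ) by rw [he]; ring, ← rpow_mul_cutWeight _ _ _ hz,
            ← ENNReal.rpow_mul]
          exact mul_le_of_le_one_right' (cutWeight_le_one (by positivity) hσ hz)
        calc _ ≤ (cutWeight e σ z * F z ^ p) * (C * ‖z‖ₑ ^ δ * N) := by gcongr
          _ = C * N * ((cutWeight e σ z * ‖z‖ₑ ^ δ) * F z ^ p) := by ring
          _ ≤ C * N * ((‖z‖ₑ ^ ν) ^ p * F z ^ p) := by gcongr
          _ = _ := by rw [ENNReal.mul_rpow_of_nonneg _ _ hp0.le]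
    _ = (C ^ (p - 1) * 2 ^ (e + σ) * C) * (powNorm ν p F * (N ^ (p - 1) * N)) := by
        rw [lintegral_const_mul _ (by fun_prop), powNorm]
        ring
    _ = _ := by
        have : N ^ (p - 1) * N = powNorm ν p G := by
          nth_rewrite 2 [← ENNReal.rpow_one N]
          rw [← ENNReal.rpow_add_of_nonneg _ _ hp1.le zero_le_one, hN, ← ENNReal.rpow_mul,
            sub_add_cancel, one_div_mul_cancel hp0.ne', ENNReal.rpow_one]
        rw [this]

/-- Cauchy-Schwarz and the tail bound estimate the far part pointwise by a power of `‖y‖`. It only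
remains to integrate that power against the weight, which needs the strict inequality `p(1 + δ) < σ`
at infinity. -/
lemma exists_farConv_le (hd : 2 ≤ d) {ν p σ : ℝ} (hp : 2 < p)
    (hν : d * (1 - 2 / p) < 2 * ν) (hσ0 : 0 < p * (1 + (d * (1 - 1 / p) - ν)))
    (hσ : p * (1 + (d * (1 - 1 / p) - ν)) < σ) :
    ∃ C : ℝ≥0∞, C ≠ ∞ ∧ ∀ F G : RSpace d → ℝ≥0∞, Measurable F → Measurable G →
      ∫⁻ y, cutWeight (p * (1 + ν)) σ y * farConv F G y ^ p ≤
        C * (powNorm ν p F * powNorm ν p G) := by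
  obtain ⟨C, hC, hb⟩ := exists_tail_lintegral_sq_le hd hp hν
  have hfin := lintegral_enorm_rpow_mul_min_lt_top hd hσ0 hσ
  have hp0 : 0 < p := by linarith
  refine ⟨C ^ p * _, ENNReal.mul_ne_top (ENNReal.rpow_ne_top_of_nonneg hp0.le hC) hfin.ne,
    fun F G hF hG => ?_⟩
  have key : ∀ y : RSpace d, y ≠ 0 → farConv F G y ≤
      C * ‖y‖ₑ ^ (d * (1 - 2 / p) - 2 * ν) * (powNorm ν p F * powNorm ν p G) ^ (1 / p) := by
    intro y hy
    have h := ENNReal.lintegral_mul_norm_pow_le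
      (μ := volume.restrict {x | ‖y‖ ≤ 2 * ‖x‖ ∧ ‖y‖ ≤ 2 * ‖y - x‖})
      (f := fun x => F (y - x) ^ (2 : ℝ)) (g := fun x => G x ^ (2 : ℝ)) (p := 1 / 2) (q := 1 / 2)
      (by fun_prop) (by fun_prop) (by norm_num) (by norm_num) (by norm_num)
    have e2 : (2 : ℝ) * (1 / 2) = 1 := by norm_num
    simp only [← ENNReal.rpow_mul, e2, ENNReal.rpow_one] at h
    have hG2 : ∫⁻ x in {x | ‖y‖ ≤ 2 * ‖x‖ ∧ ‖y‖ ≤ 2 * ‖y - x‖}, G x ^ (2 : ℝ) ≤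
        C * ‖y‖ₑ ^ (d * (1 - 2 / p) - 2 * ν) * powNorm ν p G ^ (2 / p) :=
      le_trans (lintegral_mono_set fun x hx => hx.1) (hb G hG y hy)
    have hF2 : ∫⁻ x in {x | ‖y‖ ≤ 2 * ‖x‖ ∧ ‖y‖ ≤ 2 * ‖y - x‖}, F (y - x) ^ (2 : ℝ) ≤
        C * ‖y‖ₑ ^ (d * (1 - 2 / p) - 2 * ν) * powNorm ν p F ^ (2 / p) := by
      refine le_trans (lintegral_mono_set (t := {x | ‖y‖ ≤ 2 * ‖y - x‖}) fun x hx => hx.2) ?_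
      refine le_trans (le_of_eq ?_) (hb F hF y hy)
      have hm1 : MeasurableSet {x : RSpace d | ‖y‖ ≤ 2 * ‖y - x‖} :=
        measurableSet_le (by fun_prop) (by fun_prop)
      have hm2 : MeasurableSet {x : RSpace d | ‖y‖ ≤ 2 * ‖x‖} :=
        measurableSet_le (by fun_prop) (by fun_prop)
      rw [← lintegral_indicator hm1, ← lintegral_indicator hm2,
        ← lintegral_sub_left_eq_self (Set.indicator {x | ‖y‖ ≤ 2 * ‖x‖} _) y]
      rfl
    rw [farConv]
    refine h.trans ?_
    refine (mul_le_mul' (ENNReal.rpow_le_rpow hF2 one_half_pos.le)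
      (ENNReal.rpow_le_rpow hG2 one_half_pos.le)).trans_eq ?_
    rw [ENNReal.mul_rpow_of_nonneg _ _ (by norm_num : (0 : ℝ) ≤ 1 / 2),
      ENNReal.mul_rpow_of_nonneg _ (powNorm ν p G ^ (2 / p)) (by norm_num : (0 : ℝ) ≤ 1 / 2),
      ENNReal.mul_rpow_of_nonneg _ _ (by positivity : (0 : ℝ) ≤ 1 / p),
      ← ENNReal.rpow_mul, ← ENNReal.rpow_mul]
    have e1 : 2 / p * (1 / 2) = 1 / p := by ring
    rw [e1, mul_mul_mul_comm, ← ENNReal.rpow_add_of_nonneg _ _ (by norm_num) (by norm_num)]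
    norm_num
  calc _ ≤ ∫⁻ y : RSpace d, C ^ p * (powNorm ν p F * powNorm ν p G) *
        (‖y‖ₑ ^ (p * (1 + (d * (1 - 1 / p) - ν)) - d) * min 1 (‖y‖ₑ ^ (-σ))) := by
        refine lintegral_mono_ae ?_
        filter_upwards [ae_ne_zero hd] with y hy
        refine (mul_le_mul' le_rfl (ENNReal.rpow_le_rpow (key y hy) hp0.le)).trans_eq ?_
        rw [ENNReal.mul_rpow_of_nonneg _ _ hp0.le, ENNReal.mul_rpow_of_nonneg _ _ hp0.le,
          ← ENNReal.rpow_mul, ← ENNReal.rpow_mul, one_div_mul_cancel hp0.ne', ENNReal.rpow_one]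
        have := rpow_mul_cutWeight ((d * (1 - 2 / p) - 2 * ν) * p) (p * (1 + ν)) σ hy
        rw [show (d * (1 - 2 / p) - 2 * ν) * p + p * (1 + ν) =
          p * (1 + (d * (1 - 1 / p) - ν)) - d by field_simp; ring] at this
        rw [← cutWeight, ← this]
        ring
    _ = _ := by
        rw [lintegral_const_mul _ (by fun_prop)]
        ring

/-- The reflection `x ↦ y - x` exchanges the roles of `F` and `G`, so the two near regions are
handled by a single estimate. -/
lemma conv_le_near_add_far (F G : RSpace d → ℝ≥0∞) (y : RSpace d) :
    ∫⁻ x, F (y - x) * G x ≤ nearConv F G y + nearConv G F y + farConv F G y := by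
  have hm1 : MeasurableSet {x : RSpace d | 2 * ‖x‖ ≤ ‖y‖} :=
    measurableSet_le (by fun_prop) (by fun_prop)
  have hm2 : MeasurableSet {x : RSpace d | 2 * ‖y - x‖ ≤ ‖y‖} :=
    measurableSet_le (by fun_prop) (by fun_prop)
  have e1 : nearConv F G y = ∫⁻ x in {x | 2 * ‖x‖ ≤ ‖y‖}, F (y - x) * G x := by
    rw [nearConv]; simp only [mul_comm]
  have e2 : nearConv G F y = ∫⁻ x in {x | 2 * ‖y - x‖ ≤ ‖y‖}, F (y - x) * G x := by
    rw [nearConv, ← lintegral_indicator hm1, ← lintegral_indicator hm2,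
      ← lintegral_sub_left_eq_self _ y]
    refine lintegral_congr fun x => ?_
    simp [Set.indicator]
  rw [e1, e2, farConv]
  have huniv : (Set.univ : Set (RSpace d)) ⊆ ({x | 2 * ‖x‖ ≤ ‖y‖} ∪ {x | 2 * ‖y - x‖ ≤ ‖y‖}) ∪
      {x | ‖y‖ ≤ 2 * ‖x‖ ∧ ‖y‖ ≤ 2 * ‖y - x‖} := by
    intro x _
    simp only [Set.mem_union, Set.mem_ofPred_eq]
    rcases le_total (2 * ‖x‖) ‖y‖ with h | h
    · tauto
    · rcases le_total (2 * ‖y - x‖) ‖y‖ with h' | h' <;> tauto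
  rw [← setLIntegral_univ]
  refine (lintegral_mono_set huniv).trans ?_
  refine (lintegral_union_le _ _ _).trans ?_
  gcongr
  exact lintegral_union_le _ _ _

/-- The weighted convolution inequality. -/
theorem exists_conv_le (hd : 2 ≤ d) {ν p σ : ℝ} (hp : 2 < p) (hν0 : 0 ≤ ν)
    (hν : d * (1 - 2 / p) < 2 * ν) (hν' : ν < d * (1 - 1 / p))
    (hσ : p * (1 + (d * (1 - 1 / p) - ν)) < σ) :
    ∃ C : ℝ≥0∞, C ≠ ∞ ∧ ∀ F G : RSpace d → ℝ≥0∞, Measurable F → Measurable G →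
      ∫⁻ y, cutWeight (p * (1 + ν)) σ y * (∫⁻ x, F (y - x) * G x) ^ p ≤
        C * (powNorm ν p F * powNorm ν p G) := by
  obtain ⟨C₁, hC₁, h₁⟩ := exists_nearConv_le hd (by linarith) hν0 hν' hσ.le
  obtain ⟨C₂, hC₂, h₂⟩ := exists_farConv_le hd hp hν
    (mul_pos (by linarith) (by linarith)) hσ
  have hp1 : 1 ≤ p := by linarith
  -- The constant in `(x + y)^p ≤ 2^{p-1}(x^p + y^p)`, used twice for three summands.
  set a : ℝ≥0∞ := 2 ^ (p - 1)
  have ha : a ≠ ∞ := ENNReal.rpow_ne_top_of_nonneg (by linarith) (by simp)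
  refine ⟨a * (a * (C₁ + C₁) + C₂), by finiteness, fun F G hF hG => ?_⟩
  have mcw := measurable_cutWeight (d := d) (p * (1 + ν)) σ
  have mN : ∀ {F G : RSpace d → ℝ≥0∞}, Measurable F → Measurable G → Measurable (nearConv F G) := by
    intro F G hF hG
    have hS : MeasurableSet {q : RSpace d × RSpace d | 2 * ‖q.2‖ ≤ ‖q.1‖} :=
      measurableSet_le (by fun_prop) (by fun_prop)
    have h : Measurable fun q : RSpace d × RSpace d =>
        {x : RSpace d | 2 * ‖x‖ ≤ ‖q.1‖}.indicator (fun x => G x * F (q.1 - x)) q.2 :=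
      Measurable.indicator (f := fun q : RSpace d × RSpace d => G q.2 * F (q.1 - q.2))
        (by fun_prop) hS
    convert! h.lintegral_prod_right' (ν := volume) using 2 with y
    exact (lintegral_indicator (measurableSet_le (by fun_prop) (by fun_prop)) _).symm
  have key : ∀ y, (∫⁻ x, F (y - x) * G x) ^ p ≤
      a * (a * (nearConv F G y ^ p + nearConv G F y ^ p) + farConv F G y ^ p) := by
    intro y
    refine (ENNReal.rpow_le_rpow (conv_le_near_add_far F G y) (by linarith)).trans ?_
    refine (ENNReal.rpow_add_le_mul_rpow_add_rpow _ _ hp1).trans ?_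
    gcongr
    exact ENNReal.rpow_add_le_mul_rpow_add_rpow _ _ hp1
  set w := cutWeight (d := d) (p * (1 + ν)) σ
  have mFG := mN hF hG
  have mGF := mN hG hF
  calc _ ≤ ∫⁻ y, a * (a * (w y * nearConv F G y ^ p + w y * nearConv G F y ^ p) +
        w y * farConv F G y ^ p) := by
        refine lintegral_mono fun y => (mul_le_mul' le_rfl (key y)).trans_eq ?_
        ring
    _ = a * (a * ((∫⁻ y, w y * nearConv F G y ^ p) + ∫⁻ y, w y * nearConv G F y ^ p) +
        ∫⁻ y, w y * farConv F G y ^ p) := by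
        rw [lintegral_const_mul' _ _ ha, lintegral_add_left (by fun_prop),
          lintegral_const_mul' _ _ ha, lintegral_add_left (by fun_prop)]
    _ ≤ a * (a * (C₁ * (powNorm ν p F * powNorm ν p G) + C₁ * (powNorm ν p G * powNorm ν p F)) +
        C₂ * (powNorm ν p F * powNorm ν p G)) := by
        gcongr
        exacts [h₁ F G hF hG, h₁ G F hG hF, h₂ F G hF hG]
    _ = _ := by ring

/-! ### The bilinear estimate -/

/-- The nonlinear term with the field values replaced by sizes `f`, `g`. -/
noncomputable def majorant (γ β : ℝ) (f g : RSpace d → ℝ≥0∞) (η : RSpace d) : ℝ≥0∞ :=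
  ∫⁻ t in Set.Ioc (1 : ℝ) (1 / β),
    ENNReal.ofReal (Real.exp (‖η‖ ^ γ * (1 - t ^ γ)) / t ^ scalingExp d γ) *
      (‖η‖ₑ * ∫⁻ x, f (t • η - x) * g x)

/-- The `p`-th power of the norm of `L^p` with the weight `u_ν`. -/
noncomputable def wpow (ν p : ℝ) (f : RSpace d → ℝ≥0∞) : ℝ≥0∞ :=
  ∫⁻ x, (ENNReal.ofReal (weight ν x) * f x) ^ p

lemma ofReal_weight {ν : ℝ} (hν : 0 ≤ ν) (x : RSpace d) :
    ENNReal.ofReal (weight ν x) = ENNReal.ofReal (Real.exp ‖x‖) * ‖x‖ₑ ^ ν := by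
  rw [weight, ENNReal.ofReal_mul (Real.exp_nonneg _),
    ← ENNReal.ofReal_rpow_of_nonneg (norm_nonneg x) hν, ofReal_norm]

lemma powNorm_exp_mul {ν : ℝ} (hν : 0 ≤ ν) (p : ℝ) (f : RSpace d → ℝ≥0∞) :
    powNorm ν p (fun x => ENNReal.ofReal (Real.exp ‖x‖) * f x) = wpow ν p f := by
  unfold powNorm wpow
  refine lintegral_congr fun x => ?_
  rw [ofReal_weight hν]
  ring_nf

/-- Since `t ≥ 1`, `‖η‖ ≤ ‖t • η‖ ≤ ‖t • η - x‖ + ‖x‖`. The exponential weight thus disappears into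
the two functions, and only the power weight is left. -/
lemma exp_mul_conv_le (f g : RSpace d → ℝ≥0∞) {t : ℝ} (ht : 1 ≤ t) (η : RSpace d) :
    ENNReal.ofReal (Real.exp ‖η‖) * ∫⁻ x, f (t • η - x) * g x ≤
      ∫⁻ x, (ENNReal.ofReal (Real.exp ‖t • η - x‖) * f (t • η - x)) *
        (ENNReal.ofReal (Real.exp ‖x‖) * g x) := by
  rw [← lintegral_const_mul' _ _ ENNReal.ofReal_ne_top]
  refine lintegral_mono fun x => ?_
  have h : Real.exp ‖η‖ ≤ Real.exp ‖t • η - x‖ * Real.exp ‖x‖ := by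
    rw [← Real.exp_add, Real.exp_le_exp]
    have h1 : ‖t • η‖ ≤ ‖t • η - x‖ + ‖x‖ := by simpa using norm_add_le (t • η - x) x
    rw [norm_smul, Real.norm_of_nonneg (by linarith)] at h1
    nlinarith [norm_nonneg η]
  calc _ ≤ ENNReal.ofReal (Real.exp ‖t • η - x‖ * Real.exp ‖x‖) * (f (t • η - x) * g x) := by
        gcongr
    _ = _ := by
        rw [ENNReal.ofReal_mul (Real.exp_nonneg _)]
        ring

/-- For `t > 1` and `γ ≥ 1` one has `t ^ γ ≥ t`, so the integrand is below both `1` and an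
exponential of rate `‖η‖ ^ γ`. This decay in `‖η‖` compensates the growth of the convolution
estimate. -/
lemma lintegral_exp_le {γ β : ℝ} (hγ : 1 ≤ γ) (hβ0 : 0 < β) (hβ1 : β < 1) {η : RSpace d}
    (hη : η ≠ 0) :
    ∫⁻ t in Set.Ioc (1 : ℝ) (1 / β), ENNReal.ofReal (Real.exp (‖η‖ ^ γ * (1 - t ^ γ))) ≤
      ENNReal.ofReal (1 / β) * min 1 (‖η‖ₑ ^ (-γ)) := by
  have hη0 : 0 < ‖η‖ := norm_pos_iff.2 hη
  set a := ‖η‖ ^ γ with ha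
  have ha0 : 0 < a := Real.rpow_pos_of_pos hη0 _
  have hβ : 1 ≤ 1 / β := (one_le_div hβ0).2 hβ1.le
  have hpow : ∀ t : ℝ, 1 < t → t ≤ t ^ γ := fun t ht => by
    simpa using Real.rpow_le_rpow_of_exponent_le ht.le hγ
  rw [mul_min, mul_one]
  refine le_min ?_ ?_
  · calc _ ≤ ∫⁻ t in Set.Ioc (1 : ℝ) (1 / β), 1 := by
          refine setLIntegral_mono (by fun_prop) fun t ht => ?_
          rw [ENNReal.ofReal_le_one, Real.exp_le_one_iff]
          have := hpow t ht.1
          nlinarith [ht.1]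
      _ ≤ _ := by
          rw [setLIntegral_one, Real.volume_Ioc]
          exact ENNReal.ofReal_le_ofReal (by linarith)
  · have hint := integrableOn_exp_mul_Ioi (a := -a) (by linarith) 1
    have hval := integral_exp_mul_Ioi (a := -a) (by linarith) 1
    have h2 := ofReal_integral_eq_lintegral_ofReal hint
      (Filter.Eventually.of_forall fun x => Real.exp_nonneg _)
    have e1 : ∫⁻ t in Set.Ioi (1 : ℝ), ENNReal.ofReal (Real.exp (a * (1 - t))) =
        ENNReal.ofReal a⁻¹ := by
      have e2 : ∀ t : ℝ, ENNReal.ofReal (Real.exp (a * (1 - t))) =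
          ENNReal.ofReal (Real.exp a) * ENNReal.ofReal (Real.exp (-a * t)) := fun t => by
        rw [← ENNReal.ofReal_mul (Real.exp_nonneg _), ← Real.exp_add]; ring_nf
      simp only [e2]
      rw [lintegral_const_mul' _ _ ENNReal.ofReal_ne_top, ← h2, hval,
        ← ENNReal.ofReal_mul (Real.exp_nonneg _)]
      congr 1
      rw [mul_one, neg_div_neg_eq, ← mul_div_assoc, ← Real.exp_add, add_neg_cancel, Real.exp_zero,
        one_div]
    calc _ ≤ ∫⁻ t in Set.Ioc (1 : ℝ) (1 / β), ENNReal.ofReal (Real.exp (a * (1 - t))) := by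
          refine setLIntegral_mono (by fun_prop) fun t ht => ?_
          have := hpow t ht.1
          gcongr
      _ ≤ ∫⁻ t in Set.Ioi (1 : ℝ), ENNReal.ofReal (Real.exp (a * (1 - t))) :=
          lintegral_mono_set Set.Ioc_subset_Ioi_self
      _ = ‖η‖ₑ ^ (-γ) := by
          rw [e1, ENNReal.ofReal_inv_of_pos ha0, ha, ← ENNReal.ofReal_rpow_of_pos hη0, ofReal_norm,
            ENNReal.rpow_neg]
      _ ≤ _ := le_mul_of_one_le_left' (by simpa using hβ)

lemma measurable_conv {f g : RSpace d → ℝ≥0∞} (hf : Measurable f) (hg : Measurable g) :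
    Measurable fun y : RSpace d => ∫⁻ x, f (y - x) * g x := by
  have h : Measurable fun q : RSpace d × RSpace d => f (q.1 - q.2) * g q.2 := by fun_prop
  exact h.lintegral_prod_right'

lemma measurable_majorant (γ β : ℝ) {f g : RSpace d → ℝ≥0∞} (hf : Measurable f)
    (hg : Measurable g) : Measurable (majorant γ β f g) := by
  have hc := measurable_conv hf hg
  have h : Measurable fun q : RSpace d × ℝ =>
      ENNReal.ofReal (Real.exp (‖q.1‖ ^ γ * (1 - q.2 ^ γ)) / q.2 ^ scalingExp d γ) *
        (‖q.1‖ₑ * ∫⁻ x, f (q.2 • q.1 - x) * g x) := by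
    have h1 : Measurable fun q : RSpace d × ℝ => ∫⁻ x, f (q.2 • q.1 - x) * g x :=
      hc.comp (g := fun y : RSpace d => ∫⁻ x, f (y - x) * g x)
        (f := fun q : RSpace d × ℝ => q.2 • q.1) (by fun_prop)
    fun_prop
  exact h.lintegral_prod_right'

lemma div_rpow_le {β c : ℝ} {t : ℝ} (ht : t ∈ Set.Ioc (1 : ℝ) (1 / β)) (E : ℝ)
    (hE : 0 ≤ E) : E / t ^ c ≤ (1 / β) ^ |c| * E := by
  have ht0 : 0 < t := by linarith [ht.1]
  rw [div_eq_mul_inv, ← Real.rpow_neg ht0.le, mul_comm]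
  gcongr
  calc t ^ (-c) ≤ t ^ |c| := Real.rpow_le_rpow_of_exponent_le ht.1.le (neg_le_abs c)
    _ ≤ _ := Real.rpow_le_rpow ht0.le ht.2 (abs_nonneg c)

/-- The weighted bilinear estimate for the nonlinear term. -/
theorem exists_wpow_majorant_le (hd : 2 ≤ d) {γ β ν p : ℝ} (hγ : 1 ≤ γ) (hβ0 : 0 < β) (hβ1 : β < 1)
    (hp : 2 < p) (hν0 : 0 ≤ ν)
    (hν : d * (1 - 2 / p) < 2 * ν) (hν' : ν < d * (1 - 1 / p))
    (hσ : p * (1 + (d * (1 - 1 / p) - ν)) < γ * (p - 1)) :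
    ∃ C : ℝ≥0∞, C ≠ ∞ ∧ ∀ f g : RSpace d → ℝ≥0∞, Measurable f → Measurable g →
      wpow ν p (majorant γ β f g) ≤ C * (wpow ν p f * wpow ν p g) := by
  obtain ⟨C, hC, hconv⟩ := exists_conv_le hd hp hν0 hν hν' hσ
  have hp0 : 0 < p := by linarith
  have hp1 : 0 < p - 1 := by linarith
  have hβ : 1 ≤ 1 / β := (one_le_div hβ0).2 hβ1.le
  -- Jensen raises the `t`-integral of the density, of order `‖η‖ ^ (-γ)`, to the power `p - 1`.
  set σ := γ * (p - 1) with hσd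
  have hσ0 : 0 ≤ σ := by positivity
  set K : ℝ≥0∞ := ENNReal.ofReal ((1 / β) ^ |scalingExp d γ|) with hK
  set b : ℝ≥0∞ := ENNReal.ofReal (1 / β) with hb
  have hKt : K ≠ ∞ := ENNReal.ofReal_ne_top
  have hbt : b ≠ ∞ := ENNReal.ofReal_ne_top
  have hb1 : 1 ≤ b := by simpa [hb] using hβ
  set e := p * (1 + ν) with he
  have he0 : 0 ≤ e := by positivity
  have hKp : K ^ p ≠ ∞ := ENNReal.rpow_ne_top_of_nonneg hp0.le hKt
  have hbp : b ^ (p - 1) ≠ ∞ := ENNReal.rpow_ne_top_of_nonneg hp1.le hbt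
  have hbe : b ^ (e + σ) ≠ ∞ := ENNReal.rpow_ne_top_of_nonneg (by positivity) hbt
  refine ⟨K ^ p * b ^ (p - 1) * (b ^ (e + σ) * b * C), by finiteness, fun f g hf hg => ?_⟩
  set F : RSpace d → ℝ≥0∞ := fun x => ENNReal.ofReal (Real.exp ‖x‖) * f x with hF
  set G : RSpace d → ℝ≥0∞ := fun x => ENNReal.ofReal (Real.exp ‖x‖) * g x with hG
  have mF : Measurable F := by fun_prop
  have mG : Measurable G := by fun_prop
  set H : RSpace d → ℝ≥0∞ := fun y => ∫⁻ x, F (y - x) * G x with hH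
  have mH : Measurable H := measurable_conv mF mG
  have mcw := measurable_cutWeight (d := d) e σ
  set I : Set ℝ := Set.Ioc (1 : ℝ) (1 / β) with hI
  have mI : MeasurableSet I := measurableSet_Ioc
  set E : RSpace d → ℝ → ℝ≥0∞ := fun η t => ENNReal.ofReal (Real.exp (‖η‖ ^ γ * (1 - t ^ γ)))
  have step1 : ∀ η : RSpace d, η ≠ 0 → ENNReal.ofReal (weight ν η) * majorant γ β f g η ≤
      K * (‖η‖ₑ ^ (1 + ν) * ∫⁻ t in I, E η t * H (t • η)) := by
    intro η hη
    have hA : ‖η‖ₑ ^ (1 + ν) ≠ ∞ := ENNReal.rpow_ne_top_of_nonneg (by positivity) enorm_ne_top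
    rw [majorant, ← lintegral_const_mul' _ _ ENNReal.ofReal_ne_top, ← lintegral_const_mul' _ _ hA,
      ← lintegral_const_mul' _ _ hKt]
    refine setLIntegral_mono (by fun_prop) fun t ht => ?_
    have h1 : ENNReal.ofReal (Real.exp (‖η‖ ^ γ * (1 - t ^ γ)) / t ^ scalingExp d γ) ≤ K * E η t := by
      rw [hK, ← ENNReal.ofReal_mul (by positivity)]
      exact ENNReal.ofReal_le_ofReal (div_rpow_le ht _ (Real.exp_nonneg _))
    have h2 := exp_mul_conv_le f g ht.1.le η
    calc _ = ENNReal.ofReal (Real.exp (‖η‖ ^ γ * (1 - t ^ γ)) / t ^ scalingExp d γ) *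
          ((‖η‖ₑ * ‖η‖ₑ ^ ν) *
            (ENNReal.ofReal (Real.exp ‖η‖) * ∫⁻ x, f (t • η - x) * g x)) := by
          rw [ofReal_weight hν0]; ring
      _ ≤ (K * E η t) * ((‖η‖ₑ * ‖η‖ₑ ^ ν) * H (t • η)) := by gcongr
      _ = _ := by
          rw [ENNReal.rpow_add_of_nonneg _ _ zero_le_one hν0, ENNReal.rpow_one]; ring
  have step2 : ∀ η : RSpace d, η ≠ 0 →
      (ENNReal.ofReal (weight ν η) * majorant γ β f g η) ^ p ≤
        K ^ p * b ^ (p - 1) * ∫⁻ t in I, cutWeight e σ η * H (t • η) ^ p := by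
    intro η hη
    have hE1 : ∀ t ∈ I, E η t ≤ 1 := by
      intro t ht
      rw [ENNReal.ofReal_le_one, Real.exp_le_one_iff]
      have : 1 ≤ t ^ γ := Real.one_le_rpow ht.1.le (by linarith)
      exact mul_nonpos_of_nonneg_of_nonpos (by positivity) (by linarith)
    have h1 : (∫⁻ t in I, E η t * H (t • η)) ^ p ≤
        (b * min 1 (‖η‖ₑ ^ (-γ))) ^ (p - 1) * ∫⁻ t in I, H (t • η) ^ p := by
      refine (lintegral_mul_rpow_le (by linarith) (by fun_prop) (by fun_prop)).trans ?_
      refine mul_le_mul' (ENNReal.rpow_le_rpow ?_ hp1.le) ?_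
      · exact lintegral_exp_le hγ hβ0 hβ1 hη
      · refine setLIntegral_mono (by fun_prop) fun t ht => ?_
        exact mul_le_of_le_one_left' (hE1 t ht)
    have h2 : (min 1 (‖η‖ₑ ^ (-γ))) ^ (p - 1) ≤ min 1 (‖η‖ₑ ^ (-σ)) := by
      refine le_min (ENNReal.rpow_le_one (min_le_left _ _) hp1.le) ?_
      refine (ENNReal.rpow_le_rpow (min_le_right _ _) hp1.le).trans_eq ?_
      rw [← ENNReal.rpow_mul, hσd, neg_mul]
    calc _ ≤ (K * (‖η‖ₑ ^ (1 + ν) * ∫⁻ t in I, E η t * H (t • η))) ^ p :=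
          ENNReal.rpow_le_rpow (step1 η hη) hp0.le
      _ = K ^ p * (‖η‖ₑ ^ e * (∫⁻ t in I, E η t * H (t • η)) ^ p) := by
          rw [ENNReal.mul_rpow_of_nonneg _ _ hp0.le, ENNReal.mul_rpow_of_nonneg _ _ hp0.le,
            ← ENNReal.rpow_mul, he, mul_comm p]
      _ ≤ K ^ p * (‖η‖ₑ ^ e * ((b ^ (p - 1) * min 1 (‖η‖ₑ ^ (-σ))) *
            ∫⁻ t in I, H (t • η) ^ p)) := by
          gcongr
          refine h1.trans ?_
          rw [ENNReal.mul_rpow_of_nonneg _ _ hp1.le]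
          gcongr
      _ = _ := by
          rw [lintegral_const_mul (f := fun t : ℝ => H (t • η) ^ p) _ (by fun_prop), cutWeight]
          ring
  have step3 : ∀ t ∈ I, ∫⁻ η, cutWeight e σ η * H (t • η) ^ p ≤
      b ^ (e + σ) * ∫⁻ y, cutWeight e σ y * H y ^ p := by
    intro t ht
    have ht0 : 0 < t := by linarith [ht.1]
    calc _ ≤ ∫⁻ η, b ^ (e + σ) * (cutWeight e σ (t • η) * H (t • η) ^ p) := by
          refine lintegral_mono fun η => ?_
          simp only
          rw [← mul_assoc]
          gcongr
          have hn : ‖t • η‖ = t * ‖η‖ := by rw [norm_smul, Real.norm_of_nonneg ht0.le]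
          refine cutWeight_le he0 hσ0 hb1 hbt (enorm_le_ofReal_mul ?_) (enorm_le_ofReal_mul ?_)
          · rw [hn, ← mul_assoc]
            exact le_mul_of_one_le_left (norm_nonneg _) (by nlinarith [ht.1])
          · rw [hn]
            exact mul_le_mul_of_nonneg_right ht.2 (norm_nonneg _)
      _ = b ^ (e + σ) * (ENNReal.ofReal t ^ (-(d : ℝ)) * ∫⁻ y, cutWeight e σ y * H y ^ p) := by
          rw [lintegral_const_mul' _ _ hbe,
            lintegral_comp_smul (fun y => cutWeight e σ y * H y ^ p) ht0]
      -- The Jacobian `t ^ (-d)` is at most `1`.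
      _ ≤ _ := by
          gcongr
          refine mul_le_of_le_one_left' ?_
          rw [ENNReal.rpow_neg, ENNReal.inv_le_one]
          have : 1 ≤ ENNReal.ofReal t := by simpa using ht.1.le
          simpa using ENNReal.rpow_le_rpow this (Nat.cast_nonneg d : (0 : ℝ) ≤ d)
  calc wpow ν p (majorant γ β f g)
      ≤ ∫⁻ η, K ^ p * b ^ (p - 1) * ∫⁻ t in I, cutWeight e σ η * H (t • η) ^ p := by
        refine lintegral_mono_ae ?_
        filter_upwards [ae_ne_zero hd] with η hη using step2 η hη
    _ = K ^ p * b ^ (p - 1) * ∫⁻ t in I, ∫⁻ η, cutWeight e σ η * H (t • η) ^ p := by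
        rw [lintegral_const_mul' _ _ (by finiteness), lintegral_lintegral_swap]
        have : Measurable fun q : RSpace d × ℝ => cutWeight e σ q.1 * H (q.2 • q.1) ^ p := by
          fun_prop
        exact this.aemeasurable
    _ ≤ K ^ p * b ^ (p - 1) * ∫⁻ t in I, b ^ (e + σ) * (C * (wpow ν p f * wpow ν p g)) := by
        refine mul_le_mul' le_rfl ?_
        refine setLIntegral_mono (by fun_prop) fun t ht => (step3 t ht).trans ?_
        gcongr
        refine (hconv F G mF mG).trans_eq ?_
        rw [powNorm_exp_mul hν0, powNorm_exp_mul hν0]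
    _ ≤ K ^ p * b ^ (p - 1) * ((b ^ (e + σ) * (C * (wpow ν p f * wpow ν p g))) * b) := by
        rw [setLIntegral_const, Real.volume_Ioc]
        gcongr
        exact ENNReal.ofReal_le_ofReal (by linarith)
    _ = _ := by ring

/-! ### Weighted norms -/

/-- The weighted norm of a nonnegative function. -/
noncomputable def ewnorm (ν p : ℝ) (f : RSpace d → ℝ≥0∞) : ℝ≥0∞ := wpow ν p f ^ (1 / p)

lemma weight_nonneg (ν : ℝ) (x : RSpace d) : 0 ≤ weight ν x := by
  unfold weight; positivity

lemma weight_pos (ν : ℝ) {x : RSpace d} (hx : x ≠ 0) : 0 < weight ν x := by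
  have := norm_pos_iff.2 hx
  unfold weight; positivity

lemma measurable_weight (ν : ℝ) : Measurable (weight (d := d) ν) := by
  unfold weight; fun_prop

lemma wnorm_eq_ewnorm {ν p : ℝ} (hp : 0 < p) (f : RSpace d → CSpace d) :
    wnorm ν p f = ewnorm ν p fun x => ‖f x‖ₑ := by
  rw [wnorm, eLpNorm_eq_lintegral_rpow_enorm_toReal (by simpa using hp) ENNReal.ofReal_ne_top,
    ENNReal.toReal_ofReal hp.le, ewnorm, wpow]
  congr 1
  refine lintegral_congr fun x => ?_
  rw [enorm_smul, Real.enorm_eq_ofReal (weight_nonneg ν x)]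

lemma ewnorm_mono_ae {ν p : ℝ} (hp : 0 < p) {f g : RSpace d → ℝ≥0∞} (h : ∀ᵐ x, f x ≤ g x) :
    ewnorm ν p f ≤ ewnorm ν p g := by
  refine ENNReal.rpow_le_rpow (lintegral_mono_ae ?_) (by positivity)
  filter_upwards [h] with x hx
  exact ENNReal.rpow_le_rpow (mul_le_mul' le_rfl hx) hp.le

lemma ewnorm_add_le {ν p : ℝ} (hp : 1 ≤ p) {f g : RSpace d → ℝ≥0∞} (hf : Measurable f)
    (hg : Measurable g) : ewnorm ν p (fun x => f x + g x) ≤ ewnorm ν p f + ewnorm ν p g := by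
  have mw := measurable_weight (d := d) ν
  have h := ENNReal.lintegral_Lp_add_le (μ := volume) (p := p)
    (f := fun x => ENNReal.ofReal (weight ν x) * f x)
    (g := fun x => ENNReal.ofReal (weight ν x) * g x) (by fun_prop) (by fun_prop) hp
  simpa only [ewnorm, wpow, mul_add, Pi.add_apply] using h

lemma ewnorm_const_mul {ν p : ℝ} (hp : 0 < p) {a : ℝ≥0∞} (ha : a ≠ ∞) (f : RSpace d → ℝ≥0∞) :
    ewnorm ν p (fun x => a * f x) = a * ewnorm ν p f := by
  have e : ∀ x : RSpace d, (ENNReal.ofReal (weight ν x) * (a * f x)) ^ p =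
      a ^ p * (ENNReal.ofReal (weight ν x) * f x) ^ p := fun x => by
    rw [← ENNReal.mul_rpow_of_nonneg _ _ hp.le]; ring_nf
  simp only [ewnorm, wpow, e]
  rw [lintegral_const_mul' _ _ (ENNReal.rpow_ne_top_of_nonneg hp.le ha),
    ENNReal.mul_rpow_of_nonneg _ _ (by positivity), ← ENNReal.rpow_mul, mul_one_div_cancel hp.ne',
    ENNReal.rpow_one]

lemma ae_lt_top_of_ewnorm (hd : 2 ≤ d) {ν p : ℝ} (hp : 0 < p) {f : RSpace d → ℝ≥0∞}
    (hf : Measurable f) (h : ewnorm ν p f < ∞) : ∀ᵐ x, f x < ∞ := by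
  have mw := measurable_weight (d := d) ν
  have h1 : wpow ν p f ≠ ∞ := by
    intro h2
    simp [ewnorm, h2, hp] at h
  filter_upwards [ae_lt_top (by fun_prop) h1, ae_ne_zero hd] with x hx hx0
  by_contra hcon
  rw [not_lt_top_iff] at hcon
  have : ENNReal.ofReal (weight ν x) ≠ 0 := by simpa using weight_pos ν hx0
  rw [hcon, ENNReal.mul_top this, ENNReal.top_rpow_of_pos hp] at hx
  exact lt_irrefl _ hx

lemma ae_eq_zero_of_wnorm (hd : 2 ≤ d) {ν p : ℝ} (hp : 0 < p) {f : RSpace d → CSpace d}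
    (hf : AEStronglyMeasurable f) (h : wnorm ν p f = 0) : f =ᵐ[volume] 0 := by
  have mw := measurable_weight (d := d) ν
  have h' := (eLpNorm_eq_zero_iff (mw.aestronglyMeasurable.smul hf) (by simpa using hp)).1 h
  filter_upwards [h', ae_ne_zero hd] with x hx hx0
  exact (smul_eq_zero.1 hx).resolve_left (weight_pos ν hx0).ne'

/-- The bilinear estimate in terms of norms. -/
theorem exists_ewnorm_majorant_le (hd : 2 ≤ d) {γ β ν p : ℝ} (hγ : 1 ≤ γ) (hβ0 : 0 < β)
    (hβ1 : β < 1) (hp : 2 < p) (hν0 : 0 ≤ ν)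
    (hν : d * (1 - 2 / p) < 2 * ν) (hν' : ν < d * (1 - 1 / p))
    (hσ : p * (1 + (d * (1 - 1 / p) - ν)) < γ * (p - 1)) :
    ∃ C : ℝ≥0∞, C ≠ ∞ ∧ ∀ f g : RSpace d → ℝ≥0∞, Measurable f → Measurable g →
      ewnorm ν p (majorant γ β f g) ≤ C * (ewnorm ν p f * ewnorm ν p g) := by
  obtain ⟨C, hC, h⟩ := exists_wpow_majorant_le hd hγ hβ0 hβ1 hp hν0 hν hν' hσ
  have hp0 : 0 < 1 / p := by positivity
  refine ⟨C ^ (1 / p), ENNReal.rpow_ne_top_of_nonneg hp0.le hC, fun f g hf hg => ?_⟩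
  refine (ENNReal.rpow_le_rpow (h f g hf hg) hp0.le).trans_eq ?_
  rw [ENNReal.mul_rpow_of_nonneg _ _ hp0.le, ENNReal.mul_rpow_of_nonneg _ _ hp0.le]
  rfl

/-- The linear term with the field values replaced by sizes. -/
noncomputable def linTerm (γ β : ℝ) (f : RSpace d → ℝ≥0∞) (η : RSpace d) : ℝ≥0∞ :=
  ENNReal.ofReal (β ^ scalingExp d γ * Real.exp (‖η‖ ^ γ * (1 - 1 / β ^ γ))) * f (β⁻¹ • η)

lemma measurable_linTerm (γ β : ℝ) {f : RSpace d → ℝ≥0∞} (hf : Measurable f) :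
    Measurable (linTerm γ β f) := by
  unfold linTerm; fun_prop

/-- The power `β ^ c` is explicit, the power weight contributes `β ^ ν` and the Jacobian `β ^ (d /
p)`. The remaining exponentials can only decrease under the dilation by `β⁻¹`. -/
lemma ewnorm_linTerm_le {γ β ν p : ℝ} (hγ : 0 ≤ γ) (hβ0 : 0 < β) (hβ1 : β < 1) (hp : 0 < p)
    (f : RSpace d → ℝ≥0∞) :
    ewnorm ν p (linTerm γ β f) ≤
      ENNReal.ofReal (β ^ (scalingExp d γ + ν + d / p)) * ewnorm ν p f := by
  set c := scalingExp d γ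
  have key : ∀ η : RSpace d, ENNReal.ofReal (weight ν η) * linTerm γ β f η ≤
      ENNReal.ofReal (β ^ (c + ν)) *
        (ENNReal.ofReal (weight ν (β⁻¹ • η)) * f (β⁻¹ • η)) := by
    intro η
    rw [linTerm, ← mul_assoc, ← mul_assoc, ← ENNReal.ofReal_mul (weight_nonneg ν η),
      ← ENNReal.ofReal_mul (by positivity)]
    refine mul_le_mul' (ENNReal.ofReal_le_ofReal ?_) le_rfl
    have h1 : Real.exp (‖η‖ ^ γ * (1 - 1 / β ^ γ)) ≤ 1 := by
      rw [Real.exp_le_one_iff]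
      have hb : β ^ γ ≤ 1 := Real.rpow_le_one hβ0.le hβ1.le hγ
      have : 1 ≤ 1 / β ^ γ := (one_le_div (by positivity)).2 hb
      exact mul_nonpos_of_nonneg_of_nonpos (by positivity) (by linarith)
    have h2 : weight ν η ≤ β ^ ν * weight ν (β⁻¹ • η) := by
      have hn : ‖β⁻¹ • η‖ = β⁻¹ * ‖η‖ := by
        rw [norm_smul, Real.norm_of_nonneg (by positivity)]
      rw [weight, weight, hn, Real.mul_rpow (by positivity) (by positivity), Real.inv_rpow hβ0.le]
      have h3 : Real.exp ‖η‖ ≤ Real.exp (β⁻¹ * ‖η‖) :=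
        Real.exp_le_exp.2 (le_mul_of_one_le_left (norm_nonneg _) ((one_le_inv₀ hβ0).2 hβ1.le))
      have h4 : β ^ ν ≠ 0 := (Real.rpow_pos_of_pos hβ0 _).ne'
      calc Real.exp ‖η‖ * ‖η‖ ^ ν ≤ Real.exp (β⁻¹ * ‖η‖) * ‖η‖ ^ ν := by gcongr
        _ = _ := by field_simp
    calc _ ≤ (β ^ ν * weight ν (β⁻¹ • η)) * (β ^ c * 1) := by
          have := weight_nonneg ν (β⁻¹ • η)
          gcongr
      _ = _ := by rw [Real.rpow_add hβ0]; ring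
  have h1 : wpow ν p (linTerm γ β f) ≤
      ENNReal.ofReal (β ^ (c + ν)) ^ p * (ENNReal.ofReal β⁻¹ ^ (-(d : ℝ)) * wpow ν p f) := by
    rw [wpow, wpow, ← lintegral_comp_smul (fun x => (ENNReal.ofReal (weight ν x) * f x) ^ p)
      (inv_pos.2 hβ0), ← lintegral_const_mul' _ _
      (ENNReal.rpow_ne_top_of_nonneg hp.le ENNReal.ofReal_ne_top)]
    refine lintegral_mono fun η => ?_
    simp only
    rw [← ENNReal.mul_rpow_of_nonneg _ _ hp.le]
    exact ENNReal.rpow_le_rpow (key η) hp.le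
  refine (ENNReal.rpow_le_rpow h1 (by positivity)).trans_eq ?_
  rw [← mul_assoc, ENNReal.mul_rpow_of_nonneg _ _ (by positivity), ewnorm]
  congr 1
  rw [ENNReal.ofReal_rpow_of_pos (by positivity), ENNReal.ofReal_rpow_of_pos (by positivity),
    ← ENNReal.ofReal_mul (by positivity), ENNReal.ofReal_rpow_of_pos (by positivity)]
  congr 1
  rw [Real.inv_rpow hβ0.le, Real.rpow_neg hβ0.le, inv_inv, ← Real.rpow_mul hβ0.le,
    ← Real.rpow_add hβ0, ← Real.rpow_mul hβ0.le]
  congr 1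
  field_simp

/-! ### The bilinear integrand -/

lemma norm_dotRC_le (y : RSpace d) (v : CSpace d) : ‖dotRC y v‖ ≤ ‖y‖ * ‖v‖ := by
  have h := norm_inner_le_norm (𝕜 := ℂ) (WithLp.toLp 2 fun i => (y i : ℂ) : CSpace d) v
  have e1 : ‖(WithLp.toLp 2 fun i => (y i : ℂ) : CSpace d)‖ = ‖y‖ := by
    simp [EuclideanSpace.norm_eq]
  rw [e1] at h
  have e2 : dotRC y v = inner ℂ (WithLp.toLp 2 fun i => (y i : ℂ) : CSpace d) v := by
    simp [dotRC, PiLp.inner_apply, mul_comm]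
  rwa [e2]

/-- The triangle inequality suffices; orthogonality would improve the constant to `1`. At `y = 0`
the subtracted term vanishes. -/
lemma norm_leray_le (y : RSpace d) (v : CSpace d) : ‖leray y v‖ ≤ 2 * ‖v‖ := by
  have e1 : ‖(WithLp.toLp 2 fun i => (y i : ℂ) : CSpace d)‖ = ‖y‖ := by
    simp [EuclideanSpace.norm_eq]
  have e2 : leray y v = v - (dotRC y v / ((‖y‖ ^ 2 : ℝ) : ℂ)) •
      (WithLp.toLp 2 fun i => (y i : ℂ) : CSpace d) := by
    ext i; simp [leray]
  rw [e2]
  refine (norm_sub_le _ _).trans ?_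
  rw [norm_smul, e1, norm_div, Complex.norm_real, Real.norm_of_nonneg (by positivity), two_mul]
  gcongr
  rcases eq_or_ne y 0 with rfl | hy
  · simp
  · have hy0 : 0 < ‖y‖ := norm_pos_iff.2 hy
    rw [div_mul_eq_mul_div, div_le_iff₀ (by positivity)]
    calc ‖dotRC y v‖ * ‖y‖ ≤ (‖y‖ * ‖v‖) * ‖y‖ := by gcongr; exact norm_dotRC_le y v
      _ = _ := by ring

lemma dotRC_sub (y : RSpace d) (v w : CSpace d) : dotRC y (v - w) = dotRC y v - dotRC y w := by
  simp [dotRC, mul_sub, Finset.sum_sub_distrib]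

lemma leray_sub (y : RSpace d) (v w : CSpace d) : leray y (v - w) = leray y v - leray y w := by
  ext i
  simp only [leray, dotRC_sub, PiLp.sub_apply]
  ring

/-- The polarized integrand of the nonlinear term. -/
noncomputable def bilinIntegrand (γ : ℝ) (u v : RSpace d → CSpace d) (η : RSpace d) (t : ℝ)
    (x : RSpace d) : CSpace d :=
  (Real.exp (‖η‖ ^ γ * (1 - t ^ γ)) / t ^ scalingExp d γ) •
    (dotRC η (u (t • η - x)) • leray η (v x))

lemma nonlinIntegrand_sub (γ : ℝ) (u v : RSpace d → CSpace d) (η : RSpace d) (t : ℝ)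
    (x : RSpace d) :
    nonlinIntegrand γ u η t x - nonlinIntegrand γ v η t x =
      bilinIntegrand γ (u - v) u η t x + bilinIntegrand γ v (u - v) η t x := by
  simp only [nonlinIntegrand, bilinIntegrand, Pi.sub_apply, dotRC_sub, leray_sub, sub_smul,
    smul_sub]
  abel

lemma measurable_bilinIntegrand (γ : ℝ) {u v : RSpace d → CSpace d} (hu : Measurable u)
    (hv : Measurable v) :
    Measurable fun q : (RSpace d × ℝ) × RSpace d => bilinIntegrand γ u v q.1.1 q.1.2 q.2 := by
  unfold bilinIntegrand leray dotRC
  fun_prop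

lemma enorm_bilinIntegrand_le (γ : ℝ) (u v : RSpace d → CSpace d) (η : RSpace d) {t : ℝ}
    (ht : 0 < t) (x : RSpace d) :
    ‖bilinIntegrand γ u v η t x‖ₑ ≤
      2 * (ENNReal.ofReal (Real.exp (‖η‖ ^ γ * (1 - t ^ γ)) / t ^ scalingExp d γ) *
        (‖η‖ₑ * (‖u (t • η - x)‖ₑ * ‖v x‖ₑ))) := by
  rw [bilinIntegrand, enorm_smul, enorm_smul, Real.enorm_eq_ofReal (by positivity)]
  have h1 : ‖dotRC η (u (t • η - x))‖ₑ ≤ ‖η‖ₑ * ‖u (t • η - x)‖ₑ := by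
    rw [← ofReal_norm, ← ofReal_norm, ← ofReal_norm, ← ENNReal.ofReal_mul (norm_nonneg _)]
    exact ENNReal.ofReal_le_ofReal (norm_dotRC_le _ _)
  have h2 : ‖leray η (v x)‖ₑ ≤ 2 * ‖v x‖ₑ := by
    have := ENNReal.ofReal_le_ofReal (norm_leray_le η (v x))
    rwa [ENNReal.ofReal_mul zero_le_two, ofReal_norm, ofReal_norm, ENNReal.ofReal_ofNat] at this
  calc _ ≤ ENNReal.ofReal (Real.exp (‖η‖ ^ γ * (1 - t ^ γ)) / t ^ scalingExp d γ) *
        ((‖η‖ₑ * ‖u (t • η - x)‖ₑ) * (2 * ‖v x‖ₑ)) := by gcongr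
    _ = _ := by ring

lemma lintegral_enorm_bilinIntegrand_le (γ β : ℝ) {u v : RSpace d → CSpace d} (hu : Measurable u)
    (hv : Measurable v) (η : RSpace d) :
    ∫⁻ z, ‖bilinIntegrand γ u v η z.1 z.2‖ₑ
        ∂((volume.restrict (Set.Ioc (1 : ℝ) (1 / β))).prod volume) ≤
      2 * majorant γ β (fun x => ‖u x‖ₑ) (fun x => ‖v x‖ₑ) η := by
  have hm : Measurable fun z : ℝ × RSpace d => bilinIntegrand γ u v η z.1 z.2 :=
    (measurable_bilinIntegrand γ hu hv).comp
      (f := fun z : ℝ × RSpace d => ((η, z.1), z.2)) (by fun_prop)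
  rw [lintegral_prod _ hm.enorm.aemeasurable, majorant, ← lintegral_const_mul' _ _ (by simp)]
  have hmc : Measurable fun t : ℝ => ∫⁻ x, ‖u (t • η - x)‖ₑ * ‖v x‖ₑ :=
    (measurable_conv hu.enorm hv.enorm).comp (g := fun y => ∫⁻ x, ‖u (y - x)‖ₑ * ‖v x‖ₑ)
      (f := fun t : ℝ => t • η) (by fun_prop)
  refine setLIntegral_mono (by fun_prop) fun t ht => ?_
  rw [← lintegral_const_mul' _ _ enorm_ne_top, ← lintegral_const_mul' _ _ ENNReal.ofReal_ne_top,
    ← lintegral_const_mul' _ _ (by simp)]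
  exact lintegral_mono fun x => enorm_bilinIntegrand_le γ u v η (by linarith [ht.1]) x

lemma integrable_bilinIntegrand {γ β : ℝ} {u v : RSpace d → CSpace d} (hu : Measurable u)
    (hv : Measurable v) {η : RSpace d}
    (h : majorant γ β (fun x => ‖u x‖ₑ) (fun x => ‖v x‖ₑ) η < ∞) :
    Integrable (fun z : ℝ × RSpace d => bilinIntegrand γ u v η z.1 z.2)
      ((volume.restrict (Set.Ioc (1 : ℝ) (1 / β))).prod volume) := by
  have hm : Measurable fun z : ℝ × RSpace d => bilinIntegrand γ u v η z.1 z.2 :=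
    (measurable_bilinIntegrand γ hu hv).comp
      (f := fun z : ℝ × RSpace d => ((η, z.1), z.2)) (by fun_prop)
  exact ⟨hm.aestronglyMeasurable, lt_of_le_of_lt (lintegral_enorm_bilinIntegrand_le γ β hu hv η)
    (ENNReal.mul_lt_top (by simp) h)⟩

/-! ### Dependence on the almost everywhere class -/

/-- With the next three lemmas, this permits replacing a field of the ball by its Borel
representative `g ‖x‖`, for which joint measurability is available. -/
lemma nonlinIntegrand_congr_ae {ϑ θ : RSpace d → CSpace d} (h : ϑ =ᵐ[volume] θ) (γ : ℝ)
    (η : RSpace d) (t : ℝ) : nonlinIntegrand γ ϑ η t =ᵐ[volume] nonlinIntegrand γ θ η t := by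
  have h1 := (Measure.measurePreserving_sub_left volume (t • η)).quasiMeasurePreserving.ae h
  filter_upwards [h, h1] with x hx hx1
  simp only [nonlinIntegrand, hx, hx1]

lemma nonlinConverges_congr_ae {ϑ θ : RSpace d → CSpace d} (h : ϑ =ᵐ[volume] θ) {γ β : ℝ}
    {η : RSpace d} (hc : NonlinConverges γ β θ η) : NonlinConverges γ β ϑ η := by
  refine Integrable.congr hc ?_
  have q1 : Measure.QuasiMeasurePreserving (fun z : ℝ × RSpace d => z.1 • η - z.2)
      ((volume.restrict (Set.Ioc (1 : ℝ) (1 / β))).prod volume) volume :=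
    QuasiMeasurePreserving.prod_of_right (by fun_prop) (Filter.Eventually.of_forall fun t =>
      (Measure.measurePreserving_sub_left volume (t • η)).quasiMeasurePreserving)
  filter_upwards [q1.ae h, Measure.quasiMeasurePreserving_snd.ae h] with z hz1 hz2
  simp only [nonlinIntegrand, hz1, hz2]

lemma renorm_congr_ae {ϑ θ : RSpace d → CSpace d} (h : ϑ =ᵐ[volume] θ) (γ : ℝ) {β : ℝ}
    (hβ : 0 < β) : renorm γ β ϑ =ᵐ[volume] renorm γ β θ := by
  have h1 := (Measure.quasiMeasurePreserving_smul (volume : Measure (RSpace d))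
    (inv_ne_zero hβ.ne')).ae h
  filter_upwards [h1] with η hη
  simp only [renorm, hη]
  congr 3
  funext t
  exact integral_congr_ae (nonlinIntegrand_congr_ae h γ η t)

lemma wnorm_congr_ae {ν p : ℝ} {f g : RSpace d → CSpace d} (h : f =ᵐ[volume] g) :
    wnorm ν p f = wnorm ν p g := by
  refine eLpNorm_congr_ae ?_
  filter_upwards [h] with x hx
  rw [hx]

/-! ### Pointwise bounds for the operator -/

lemma stronglyMeasurable_renorm (γ : ℝ) {β : ℝ} (hβ0 : 0 < β) (hβ1 : β < 1)
    {u : RSpace d → CSpace d} (hu : Measurable u) : StronglyMeasurable (renorm γ β u) := by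
  have hβ : 1 ≤ 1 / β := (one_le_div hβ0).2 hβ1.le
  have h1 : StronglyMeasurable fun q : RSpace d × ℝ => ∫ x, nonlinIntegrand γ u q.1 q.2 x :=
    (measurable_bilinIntegrand γ hu hu).stronglyMeasurable.integral_prod_right' (ν := volume)
  have h2 : StronglyMeasurable fun η : RSpace d =>
      ∫ t in (1 : ℝ)..(1 / β), ∫ x, nonlinIntegrand γ u η t x := by
    simp only [intervalIntegral.integral_of_le hβ]
    exact h1.integral_prod_right' (ν := volume.restrict (Set.Ioc (1 : ℝ) (1 / β)))
  have h3 : Measurable fun η : RSpace d =>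
      (β ^ scalingExp d γ * Real.exp (‖η‖ ^ γ * (1 - 1 / β ^ γ))) • u (β⁻¹ • η) := by
    fun_prop
  exact h3.stronglyMeasurable.add (h2.const_smul (Complex.I * (γ : ℂ)))

lemma nonlin_eq_integral_prod {γ β : ℝ} (hβ0 : 0 < β) (hβ1 : β < 1) {u : RSpace d → CSpace d}
    {η : RSpace d} (h : NonlinConverges γ β u η) :
    ∫ t in (1 : ℝ)..(1 / β), ∫ x, nonlinIntegrand γ u η t x =
      ∫ z, nonlinIntegrand γ u η z.1 z.2
        ∂((volume.restrict (Set.Ioc (1 : ℝ) (1 / β))).prod volume) := by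
  have hβ : 1 ≤ 1 / β := (one_le_div hβ0).2 hβ1.le
  rw [intervalIntegral.integral_of_le hβ, integral_prod _ h]

/-- Polarization, `B(u,u) - B(v,v) = B(u-v,u) + B(v,u-v)`. In `2γ`, the `2` comes from the Leray
projection and `γ` from the prefactor. The case `v = 0` bounds the operator itself. -/
lemma enorm_renorm_sub_le {γ β : ℝ} (hγ : 0 < γ) (hβ0 : 0 < β) (hβ1 : β < 1)
    {u v : RSpace d → CSpace d} (hu : Measurable u) (hv : Measurable v) {η : RSpace d}
    (hcu : NonlinConverges γ β u η) (hcv : NonlinConverges γ β v η) :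
    ‖renorm γ β u η - renorm γ β v η‖ₑ ≤
      linTerm γ β (fun x => ‖u x - v x‖ₑ) η + ENNReal.ofReal (2 * γ) *
        (majorant γ β (fun x => ‖u x - v x‖ₑ) (fun x => ‖u x‖ₑ) η +
          majorant γ β (fun x => ‖v x‖ₑ) (fun x => ‖u x - v x‖ₑ) η) := by
  set μ : Measure (ℝ × RSpace d) := (volume.restrict (Set.Ioc (1 : ℝ) (1 / β))).prod volume
  have e1 : renorm γ β u η - renorm γ β v η =
      (β ^ scalingExp d γ * Real.exp (‖η‖ ^ γ * (1 - 1 / β ^ γ))) •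
        (u (β⁻¹ • η) - v (β⁻¹ • η)) + (Complex.I * (γ : ℂ)) •
        ∫ z, (bilinIntegrand γ (u - v) u η z.1 z.2 + bilinIntegrand γ v (u - v) η z.1 z.2) ∂μ := by
    simp only [← nonlinIntegrand_sub]
    rw [integral_sub hcu hcv, renorm, renorm, nonlin_eq_integral_prod hβ0 hβ1 hcu,
      nonlin_eq_integral_prod hβ0 hβ1 hcv, smul_sub, smul_sub]
    abel
  have huv : Measurable (u - v) := hu.sub hv
  have hI : ‖∫ z, (bilinIntegrand γ (u - v) u η z.1 z.2 +
      bilinIntegrand γ v (u - v) η z.1 z.2) ∂μ‖ₑ ≤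
        2 * majorant γ β (fun x => ‖u x - v x‖ₑ) (fun x => ‖u x‖ₑ) η +
          2 * majorant γ β (fun x => ‖v x‖ₑ) (fun x => ‖u x - v x‖ₑ) η := by
    have hm : Measurable fun z : ℝ × RSpace d => ‖bilinIntegrand γ (u - v) u η z.1 z.2‖ₑ :=
      ((measurable_bilinIntegrand γ huv hu).comp
        (f := fun z : ℝ × RSpace d => ((η, z.1), z.2)) (by fun_prop)).enorm
    calc _ ≤ ∫⁻ z, ‖bilinIntegrand γ (u - v) u η z.1 z.2 +
          bilinIntegrand γ v (u - v) η z.1 z.2‖ₑ ∂μ := enorm_integral_le_lintegral_enorm _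
      _ ≤ ∫⁻ z, (‖bilinIntegrand γ (u - v) u η z.1 z.2‖ₑ +
          ‖bilinIntegrand γ v (u - v) η z.1 z.2‖ₑ) ∂μ := lintegral_mono fun z => enorm_add_le _ _
      _ ≤ _ := by
          rw [lintegral_add_left hm]
          exact add_le_add (lintegral_enorm_bilinIntegrand_le γ β huv hu η)
            (lintegral_enorm_bilinIntegrand_le γ β hv huv η)
  rw [e1]
  refine (enorm_add_le _ _).trans (add_le_add ?_ ?_)
  · rw [enorm_smul, Real.enorm_eq_ofReal (by positivity)]
    rfl
  · have e3 : ‖Complex.I * (γ : ℂ)‖ₑ = ENNReal.ofReal γ := by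
      rw [← ofReal_norm]; simp [abs_of_pos hγ]
    rw [enorm_smul, e3, ENNReal.ofReal_mul zero_le_two, ENNReal.ofReal_ofNat]
    refine (mul_le_mul' le_rfl hI).trans_eq ?_
    ring

lemma renorm_zero (γ β : ℝ) : renorm γ β (0 : RSpace d → CSpace d) = 0 := by
  have h : ∀ η t x, nonlinIntegrand γ (0 : RSpace d → CSpace d) η t x = 0 := by
    intro η t x
    simp [nonlinIntegrand, dotRC]
  funext η
  simp [renorm, h]

lemma majorant_zero_left (γ β : ℝ) (g : RSpace d → ℝ≥0∞) (η : RSpace d) :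
    majorant γ β (fun _ => 0) g η = 0 := by
  simp [majorant]

/-! ### Radial functions -/

/-- A linear isometry preserves Lebesgue measure, so it can be substituted in the convolution.
Reflections act transitively on spheres, hence invariance means radiality. -/
lemma majorant_comp_isometry (γ β : ℝ) {f g : RSpace d → ℝ≥0∞}
    (L : RSpace d ≃ₗᵢ[ℝ] RSpace d) (hf : ∀ x, f (L x) = f x) (hg : ∀ x, g (L x) = g x)
    (η : RSpace d) : majorant γ β f g (L η) = majorant γ β f g η := by
  have h : ∀ t : ℝ, ∫⁻ x, f (t • L η - x) * g x = ∫⁻ x, f (t • η - x) * g x := by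
    intro t
    rw [← L.measurePreserving.lintegral_comp_emb L.toHomeomorph.measurableEmbedding]
    refine lintegral_congr fun x => ?_
    rw [hg, ← map_smul, ← map_sub, hf]
  have hn : ‖L η‖ₑ = ‖η‖ₑ := by rw [← ofReal_norm, ← ofReal_norm, L.norm_map]
  simp only [majorant, h, L.norm_map, hn]

lemma exists_isometry_apply_eq {x y : RSpace d} (h : ‖x‖ = ‖y‖) :
    ∃ L : RSpace d ≃ₗᵢ[ℝ] RSpace d, L x = y :=
  ⟨_, Submodule.reflection_sub h⟩

/-- The size of the image of a field whose size is `f`. -/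
noncomputable def dominator (γ β : ℝ) (f : RSpace d → ℝ≥0∞) (η : RSpace d) : ℝ≥0∞ :=
  linTerm γ β f η + ENNReal.ofReal (2 * γ) * majorant γ β f f η

lemma measurable_dominator (γ β : ℝ) {f : RSpace d → ℝ≥0∞} (hf : Measurable f) :
    Measurable (dominator γ β f) :=
  (measurable_linTerm γ β hf).add ((measurable_majorant γ β hf hf).const_mul _)

lemma dominator_radial (γ β : ℝ) (g : ℝ → ℝ≥0∞) {η ξ : RSpace d} (h : ‖η‖ = ‖ξ‖) :
    dominator γ β (fun x => g ‖x‖) η = dominator γ β (fun x => g ‖x‖) ξ := by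
  obtain ⟨L, rfl⟩ := exists_isometry_apply_eq h
  rw [dominator, dominator, majorant_comp_isometry γ β L (by simp) (by simp)]
  simp [linTerm, norm_smul]

/-! ### Convexity of the ball and the contraction on it -/

lemma convex_radialBall (d : ℕ) (ν : ℝ) {p : ℝ} (hp : 1 ≤ p) (A : ℝ) :
    Convex ℝ (radialBall d ν p A) := by
  rintro f ⟨⟨hf1, hf2⟩, ⟨g₁, mg₁, hg₁⟩, hf3⟩ g ⟨⟨hg1, hg2⟩, ⟨g₂, mg₂, hg₂⟩, hg3⟩ a b ha hb hab
  have hm : AEStronglyMeasurable (a • f + b • g) := (hf1.const_smul a).add (hg1.const_smul b)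
  have mw := measurable_weight (d := d) ν
  have hle : wnorm ν p (a • f + b • g) ≤ ENNReal.ofReal A := by
    have e : (fun x => weight ν x • (a • f + b • g) x) =
        a • (fun x => weight ν x • f x) + b • (fun x => weight ν x • g x) := by
      funext x
      simp only [Pi.add_apply, Pi.smul_apply, smul_add]
      rw [smul_comm a, smul_comm b]
    have m1 : AEStronglyMeasurable (fun x => weight ν x • f x) := mw.aestronglyMeasurable.smul hf1
    have m2 : AEStronglyMeasurable (fun x => weight ν x • g x) := mw.aestronglyMeasurable.smul hg1
    rw [wnorm, e]
    refine (eLpNorm_add_le (m1.const_smul a) (m2.const_smul b) (by simpa using hp)).trans ?_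
    rw [eLpNorm_const_smul, eLpNorm_const_smul, Real.enorm_eq_ofReal ha, Real.enorm_eq_ofReal hb]
    refine (add_le_add (mul_le_mul' le_rfl hf3) (mul_le_mul' le_rfl hg3)).trans_eq ?_
    rw [← add_mul, ← ENNReal.ofReal_add ha hb, hab, ENNReal.ofReal_one, one_mul]
  refine ⟨⟨hm, hle.trans_lt ENNReal.ofReal_lt_top⟩, ⟨a • g₁ + b • g₂, by fun_prop, ?_⟩, hle⟩
  filter_upwards [hg₁, hg₂] with x h1 h2
  simp [h1, h2]

/-- The contraction property, in terms of the parameters that the estimates use. -/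
theorem exists_contraction_radialBall (hd : 2 ≤ d) {γ β ν p : ℝ} (hγ : 1 ≤ γ) (hβ0 : 0 < β)
    (hβ1 : β < 1) (hp : 2 < p) (hν0 : 0 ≤ ν)
    (hν : d * (1 - 2 / p) < 2 * ν) (hν' : ν < d * (1 - 1 / p))
    (hσ : p * (1 + (d * (1 - 1 / p) - ν)) < γ * (p - 1))
    (hlin : 0 < scalingExp d γ + ν + d / p) :
    ∃ A : ℝ, 0 < A ∧
      (∀ ϑ ∈ radialBall d ν p A,
        (∀ᵐ η, NonlinConverges γ β ϑ η) ∧ renorm γ β ϑ ∈ radiallyBoundedBall d ν p A) ∧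
      (∃ q : NNReal, q < 1 ∧ ∀ ϑ₁ ∈ radialBall d ν p A, ∀ ϑ₂ ∈ radialBall d ν p A,
        wnorm ν p (renorm γ β ϑ₁ - renorm γ β ϑ₂) ≤ q * wnorm ν p (ϑ₁ - ϑ₂)) := by
  obtain ⟨C, hC, hmaj⟩ := exists_ewnorm_majorant_le hd hγ hβ0 hβ1 hp hν0 hν hν' hσ
  have hp0 : 0 < p := by linarith
  have hγ0 : 0 < γ := by linarith
  set b : ℝ := β ^ (scalingExp d γ + ν + d / p) with hb
  have hb0 : 0 < b := Real.rpow_pos_of_pos hβ0 _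
  have hb1 : b < 1 := Real.rpow_lt_one hβ0.le hβ1 hlin
  set k : ℝ := 2 * γ * C.toReal with hk
  have hk0 : 0 ≤ k := by positivity
  have hkC : ENNReal.ofReal (2 * γ) * C = ENNReal.ofReal k := by
    rw [hk, ENNReal.ofReal_mul (p := 2 * γ) (by positivity), ENNReal.ofReal_toReal hC]
  clear_value k
  have hlinle : ∀ f : RSpace d → ℝ≥0∞,
      ewnorm ν p (linTerm γ β f) ≤ ENNReal.ofReal b * ewnorm ν p f := fun f =>
    ewnorm_linTerm_le hγ0.le hβ0 hβ1 hp0 f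
  -- On the ball of radius `A` the Lipschitz constant is `b + 2kA`; this choice keeps it below `(1 +
  -- b) / 2`. The `+ 1` covers `k = 0`.
  set A : ℝ := (1 - b) / (4 * (k + 1)) with hA
  have hA0 : 0 < A := div_pos (by linarith) (by positivity)
  have hkA : 2 * k * A ≤ (1 - b) / 2 := by
    rw [hA, ← mul_div_assoc, div_le_div_iff₀ (by positivity) (by positivity)]
    nlinarith
  have conv : ∀ g : ℝ → CSpace d, Measurable g →
      wnorm ν p (fun x : RSpace d => g ‖x‖) ≤ ENNReal.ofReal A →
      ∀ᵐ η, NonlinConverges γ β (fun x : RSpace d => g ‖x‖) η := by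
    intro g mg hg
    have mθ : Measurable fun x : RSpace d => g ‖x‖ := by fun_prop
    have h1 := hmaj _ _ mθ.enorm mθ.enorm
    rw [wnorm_eq_ewnorm hp0] at hg
    have hfin := hg.trans_lt ENNReal.ofReal_lt_top
    have h2 := ae_lt_top_of_ewnorm hd hp0 (measurable_majorant γ β mθ.enorm mθ.enorm)
      (h1.trans_lt (by finiteness))
    filter_upwards [h2] with η hη
    exact integrable_bilinIntegrand mθ mθ hη
  refine ⟨A, hA0, ?_, ⟨((1 + b) / 2).toNNReal, ?_, ?_⟩⟩
  · rintro ϑ ⟨⟨hϑ1, hϑ2⟩, ⟨g, mg, hg⟩, hϑ3⟩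
    set θ : RSpace d → CSpace d := fun x => g ‖x‖ with hθ
    have mθ : Measurable θ := by fun_prop
    have hgθ : ϑ =ᵐ[volume] θ := hg
    rw [wnorm_congr_ae hgθ] at hϑ3
    have hc := conv g mg hϑ3
    have hw : ewnorm ν p (fun x => ‖θ x‖ₑ) ≤ ENNReal.ofReal A := by
      rwa [← wnorm_eq_ewnorm hp0]
    set D : RSpace d → ℝ≥0∞ := dominator γ β fun x => ‖θ x‖ₑ with hD
    have mD : Measurable D := measurable_dominator γ β mθ.enorm
    have hDle : ewnorm ν p D ≤ ENNReal.ofReal A := by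
      calc ewnorm ν p D ≤ ewnorm ν p (linTerm γ β fun x => ‖θ x‖ₑ) +
            ENNReal.ofReal (2 * γ) *
              ewnorm ν p (majorant γ β (fun x => ‖θ x‖ₑ) fun x => ‖θ x‖ₑ) := by
            rw [← ewnorm_const_mul hp0 ENNReal.ofReal_ne_top]
            exact ewnorm_add_le (by linarith) (measurable_linTerm γ β mθ.enorm)
              ((measurable_majorant γ β mθ.enorm mθ.enorm).const_mul _)
        _ ≤ ENNReal.ofReal b * ENNReal.ofReal A + ENNReal.ofReal (2 * γ) *
            (C * (ENNReal.ofReal A * ENNReal.ofReal A)) := by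
            refine add_le_add ((hlinle _).trans (mul_le_mul' le_rfl hw)) ?_
            refine mul_le_mul' le_rfl ((hmaj _ _ mθ.enorm mθ.enorm).trans ?_)
            gcongr
        _ = ENNReal.ofReal (b * A + k * (A * A)) := by
            rw [← mul_assoc, hkC, ← ENNReal.ofReal_mul hb0.le, ← ENNReal.ofReal_mul hA0.le,
              ← ENNReal.ofReal_mul hk0, ← ENNReal.ofReal_add (by positivity) (by positivity)]
        _ ≤ _ := ENNReal.ofReal_le_ofReal (by nlinarith)
    have hDfin := ae_lt_top_of_ewnorm hd hp0 mD (hDle.trans_lt ENNReal.ofReal_lt_top)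
    have hRθ : ∀ᵐ η, ‖renorm γ β ϑ η‖ₑ ≤ D η := by
      filter_upwards [hc, renorm_congr_ae hgθ γ hβ0] with η h1 h2
      have hc0 : NonlinConverges γ β (0 : RSpace d → CSpace d) η :=
        integrable_bilinIntegrand measurable_const measurable_const (by simp [majorant])
      have h3 := enorm_renorm_sub_le hγ0 hβ0 hβ1 mθ (measurable_const (a := (0 : CSpace d))) h1 hc0
      have h4 : renorm γ β (fun _ : RSpace d => (0 : CSpace d)) η = 0 :=
        congrFun (renorm_zero γ β) η
      simp only [h4, sub_zero, enorm_zero, majorant_zero_left, add_zero] at h3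
      rw [h2]
      exact h3
    have i0 : Fin d := ⟨0, by omega⟩
    -- The profile of the radial dominating field: the values of `D` along one ray, placed in a
    -- single component. Where `D = ∞`, `toReal` gives `0`, but this happens only on a null set.
    set G : ℝ → CSpace d := fun s =>
      (D (s • EuclideanSpace.single i0 (1 : ℝ))).toReal • EuclideanSpace.single i0 (1 : ℂ) with hG
    have mG : Measurable G := by fun_prop
    have hGn : ∀ x : RSpace d, ‖G ‖x‖‖ = (D x).toReal := by
      intro x
      have e : D (‖x‖ • EuclideanSpace.single i0 (1 : ℝ)) = D x :=
        dominator_radial γ β (fun s => ‖g s‖ₑ) (by simp [norm_smul])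
      simp only [hG, e]
      simp [norm_smul]
    have hGw : wnorm ν p (fun x : RSpace d => G ‖x‖) ≤ ENNReal.ofReal A := by
      rw [wnorm_eq_ewnorm hp0]
      refine (ewnorm_mono_ae hp0 (Filter.Eventually.of_forall fun x => ?_)).trans hDle
      rw [← ofReal_norm, hGn]
      exact ENNReal.ofReal_toReal_le
    have hRm : AEStronglyMeasurable (renorm γ β ϑ) :=
      (stronglyMeasurable_renorm γ hβ0 hβ1 mθ).aestronglyMeasurable.congr
        (renorm_congr_ae hgθ γ hβ0).symm
    have hRw : wnorm ν p (renorm γ β ϑ) ≤ ENNReal.ofReal A := by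
      rw [wnorm_eq_ewnorm hp0]
      exact (ewnorm_mono_ae hp0 hRθ).trans hDle
    refine ⟨?_, ⟨hRm, hRw.trans_lt ENNReal.ofReal_lt_top⟩, fun x => G ‖x‖, ⟨⟨?_, ?_⟩, ?_, hGw⟩, ?_⟩
    · filter_upwards [hc] with η hη using nonlinConverges_congr_ae hgθ hη
    · exact (mG.comp measurable_norm).aestronglyMeasurable
    · exact hGw.trans_lt ENNReal.ofReal_lt_top
    · exact ⟨G, mG, Filter.Eventually.of_forall fun x => rfl⟩
    · filter_upwards [hRθ, hDfin] with η h1 h2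
      rw [hGn, ← toReal_enorm]
      exact ENNReal.toReal_mono h2.ne h1
  · rw [Real.toNNReal_lt_one]
    linarith
  · rintro ϑ₁ ⟨⟨_, _⟩, ⟨g₁, mg₁, hg₁⟩, hw₁⟩ ϑ₂ ⟨⟨_, _⟩, ⟨g₂, mg₂, hg₂⟩, hw₂⟩
    set u : RSpace d → CSpace d := fun x => g₁ ‖x‖ with hu
    set v : RSpace d → CSpace d := fun x => g₂ ‖x‖ with hv
    have mu : Measurable u := by fun_prop
    have mv : Measurable v := by fun_prop
    have hgu : ϑ₁ =ᵐ[volume] u := hg₁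
    have hgv : ϑ₂ =ᵐ[volume] v := hg₂
    rw [wnorm_congr_ae hgu] at hw₁
    rw [wnorm_congr_ae hgv] at hw₂
    have hcu := conv g₁ mg₁ hw₁
    have hcv := conv g₂ mg₂ hw₂
    rw [wnorm_eq_ewnorm hp0] at hw₁ hw₂
    rw [wnorm_congr_ae ((renorm_congr_ae hgu γ hβ0).sub (renorm_congr_ae hgv γ hβ0)),
      wnorm_congr_ae (hgu.sub hgv), wnorm_eq_ewnorm hp0, wnorm_eq_ewnorm hp0]
    have mw : Measurable fun x => ‖u x - v x‖ₑ := (mu.sub mv).enorm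
    set W := ewnorm ν p fun x => ‖u x - v x‖ₑ with hW
    calc ewnorm ν p (fun x => ‖(renorm γ β u - renorm γ β v) x‖ₑ)
        ≤ ewnorm ν p (fun η => linTerm γ β (fun x => ‖u x - v x‖ₑ) η + ENNReal.ofReal (2 * γ) *
          (majorant γ β (fun x => ‖u x - v x‖ₑ) (fun x => ‖u x‖ₑ) η +
          majorant γ β (fun x => ‖v x‖ₑ) (fun x => ‖u x - v x‖ₑ) η)) := by
          refine ewnorm_mono_ae hp0 ?_
          filter_upwards [hcu, hcv] with η h1 h2
          exact enorm_renorm_sub_le hγ0 hβ0 hβ1 mu mv h1 h2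
      _ ≤ ewnorm ν p (linTerm γ β fun x => ‖u x - v x‖ₑ) + ENNReal.ofReal (2 * γ) *
          (ewnorm ν p (majorant γ β (fun x => ‖u x - v x‖ₑ) fun x => ‖u x‖ₑ) +
            ewnorm ν p (majorant γ β (fun x => ‖v x‖ₑ) fun x => ‖u x - v x‖ₑ)) := by
          have m1 := measurable_majorant γ β mw mu.enorm
          have m2 := measurable_majorant γ β mv.enorm mw
          refine (ewnorm_add_le (by linarith) (measurable_linTerm γ β mw)
            ((m1.add m2).const_mul _)).trans ?_
          refine add_le_add le_rfl ?_
          refine (ewnorm_const_mul hp0 ENNReal.ofReal_ne_top _).trans_le ?_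
          exact mul_le_mul' le_rfl (ewnorm_add_le (by linarith) m1 m2)
      _ ≤ ENNReal.ofReal b * W + ENNReal.ofReal (2 * γ) *
          (C * (W * ENNReal.ofReal A) + C * (ENNReal.ofReal A * W)) := by
          refine add_le_add (hlinle _) (mul_le_mul' le_rfl (add_le_add ?_ ?_))
          · exact (hmaj _ _ mw mu.enorm).trans
              (mul_le_mul' le_rfl (mul_le_mul' le_rfl hw₁))
          · exact (hmaj _ _ mv.enorm mw).trans
              (mul_le_mul' le_rfl (mul_le_mul' hw₂ le_rfl))
      _ = (ENNReal.ofReal b + 2 * (ENNReal.ofReal (2 * γ) * C) * ENNReal.ofReal A) * W := by ring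
      _ = ENNReal.ofReal (b + 2 * k * A) * W := by
          rw [hkC, ENNReal.ofReal_add hb0.le (by positivity), ENNReal.ofReal_mul (by positivity),
            ENNReal.ofReal_mul zero_le_two, ENNReal.ofReal_ofNat]
      _ ≤ ENNReal.ofReal ((1 + b) / 2) * W := by
          gcongr
          linarith
      _ = _ := rfl

end NSRenorm

/-! ### Reduction of the parameter conditions and uniqueness of the fixed point -/

theorem mainTheorem5 (d : ℕ) (hd : 2 ≤ d) (γ p r ν κ : ℝ) (hγ : 0 < γ)
    (hp : 1 < p) (hr : 1 < r)
    (h1_scal : 1 / r = 2 / p + (2 * ν + κ) / d - 1)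
    (h1_kappa : κ < d / r)
    (h1_nu_low : ((d : ℝ) - 1) / 2 * (1 - 2 / p) < ν)
    (h1_nu_up : ν < d * ((p - 1) / p))
    (h1_rp : p ≤ 2 * r)
    (h1_max : 0 < max ν κ)
    (h1_sum : ((d : ℝ) - 1) * (1 / r - 1 / p) ≤ ν + κ)
    (h2_low : max 0 (d + p * (NSRenorm.scalingExp d γ + ν)) <
      d * (r - p) / r + p * (ν + κ + 1))
    (h2_up : d * (r - p) / r + p * (ν + κ + 1) < γ * p * (r - 1) / r)
    (h3 : γ < γ * p * (r - 1) / r - d * (r - p) / r - p * (ν + κ + 1))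
    (h4 : r / (r - 1) < p)
    (β : ℝ) (hβ0 : 0 < β) (hβ1 : β < 1) :
    ∃ A : ℝ, 0 < A ∧
      Convex ℝ (NSRenorm.radialBall d ν p A) ∧
      (∀ ϑ ∈ NSRenorm.radialBall d ν p A,
        (∀ᵐ η, NSRenorm.NonlinConverges γ β ϑ η) ∧
        NSRenorm.renorm γ β ϑ ∈ NSRenorm.radiallyBoundedBall d ν p A) ∧
      (∃ q : NNReal, q < 1 ∧
        ∀ ϑ₁ ∈ NSRenorm.radialBall d ν p A, ∀ ϑ₂ ∈ NSRenorm.radialBall d ν p A,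
          NSRenorm.wnorm ν p (NSRenorm.renorm γ β ϑ₁ - NSRenorm.renorm γ β ϑ₂) ≤
            q * NSRenorm.wnorm ν p (ϑ₁ - ϑ₂)) ∧
      (∀ ϑ ∈ NSRenorm.radialBall d ν p A,
        NSRenorm.renorm γ β ϑ =ᵐ[MeasureTheory.volume] ϑ ↔
          ϑ =ᵐ[MeasureTheory.volume] 0) := by
  have hd0 : (2 : ℝ) ≤ d := by exact_mod_cast hd
  have hp0 : 0 < p := by linarith
  have hr0 : 0 < r := by linarith
  have hκ : κ = d * (1 / r - 2 / p + 1) - 2 * ν := by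
    rw [h1_scal]; field_simp; ring
  have hQ : d * (r - p) / r + p * (ν + κ + 1) = p * (1 + (d * (1 - 1 / p) - ν)) := by
    rw [hκ]; field_simp; ring
  have hc : d + p * (NSRenorm.scalingExp d γ + ν) = p * (γ - 1 - (d * (1 - 1 / p) - ν)) := by
    rw [NSRenorm.scalingExp]; field_simp; ring
  have hν' : ν < d * (1 - 1 / p) := by
    rwa [sub_div, div_self hp0.ne'] at h1_nu_up
  set δ : ℝ := d * (1 - 1 / p) - ν with hδ
  have hδ0 : 0 < δ := by linarith
  rw [hQ, hc] at h2_low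
  have hlow : γ - 1 - δ < 1 + δ :=
    lt_of_mul_lt_mul_left ((le_max_right _ _).trans_lt h2_low) hp0.le
  have hh3 : p * (1 + δ) < γ * (p - 1) - γ * p / r := by
    have e : γ * p * (r - 1) / r = γ * p - γ * p / r := by field_simp
    rw [e] at h3
    linarith
  have hpos : 0 < γ * p / r := by positivity
  have hσ : p * (1 + δ) < γ * (p - 1) := by linarith
  -- `hlow` says `γ / 2 < 1 + δ`; with `hσ` this gives `p / 2 < p - 1`.
  have hp2 : 2 < p := by
    have h5 : p * (γ / 2) < p * (1 + δ) := mul_lt_mul_of_pos_left (by linarith) hp0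
    nlinarith
  -- This yields both `γ ≥ 1` and the positive exponent `γ - 1 - δ` of the linear part.
  have hγδ : 1 + δ < γ := by
    have h5 : p * (1 + δ) < p * γ := by linarith
    exact lt_of_mul_lt_mul_left h5 hp0.le
  have h2p : 0 < 1 - 2 / p := by
    rw [sub_pos, div_lt_one hp0]; exact hp2
  have hν0 : 0 ≤ ν := by
    refine le_trans ?_ h1_nu_low.le
    exact mul_nonneg (by linarith) h2p.le
  -- Equivalent to `κ < d / r` once `κ` is expressed by the scaling relation.
  have hν : d * (1 - 2 / p) < 2 * ν := by
    have e : (d : ℝ) * (1 / r - 2 / p + 1) = d / r + d * (1 - 2 / p) := by ring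
    linarith
  have hlin : 0 < NSRenorm.scalingExp d γ + ν + d / p := by
    have e : NSRenorm.scalingExp d γ + ν + d / p = γ - 1 - δ := by
      rw [NSRenorm.scalingExp, hδ]; ring
    rw [e]; linarith
  obtain ⟨A, hA, hmaps, q, hq, hcontr⟩ := NSRenorm.exists_contraction_radialBall hd
    (by linarith) hβ0 hβ1 hp2 hν0 hν hν' hσ hlin
  refine ⟨A, hA, NSRenorm.convex_radialBall d ν hp.le A, hmaps, ⟨q, hq, hcontr⟩, ?_⟩
  have h0 : (0 : NSRenorm.RSpace d → NSRenorm.CSpace d) ∈ NSRenorm.radialBall d ν p A := by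
    have hz : NSRenorm.wnorm ν p (0 : NSRenorm.RSpace d → NSRenorm.CSpace d) = 0 := by
      simp [NSRenorm.wnorm]
    exact ⟨⟨MeasureTheory.aestronglyMeasurable_zero, by simp [hz]⟩,
      ⟨0, measurable_const, Filter.Eventually.of_forall fun _ => rfl⟩, by simp [hz]⟩
  intro ϑ hϑ
  -- Comparison with the fixed point `0` gives `‖R ϑ‖ ≤ q ‖ϑ‖`. A fixed point of finite nonzero norm
  -- would contradict `q < 1`; conversely, a field vanishing almost everywhere has image of norm
  -- `0`.
  have h1 := hcontr ϑ hϑ 0 h0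
  rw [NSRenorm.renorm_zero, sub_zero, sub_zero] at h1
  constructor
  · intro hfix
    refine NSRenorm.ae_eq_zero_of_wnorm (ν := ν) hd hp0 hϑ.1.1 ?_
    rw [NSRenorm.wnorm_congr_ae hfix] at h1
    by_contra hne
    have h2 : (q : ENNReal) * NSRenorm.wnorm ν p ϑ < 1 * NSRenorm.wnorm ν p ϑ :=
      ENNReal.mul_lt_mul_left hne hϑ.1.2.ne (by exact_mod_cast hq)
    rw [one_mul] at h2
    exact absurd h1 (not_le.2 h2)
  · intro hzero
    have hz : NSRenorm.wnorm ν p ϑ = 0 := by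
      rw [NSRenorm.wnorm_congr_ae hzero]
      simp [NSRenorm.wnorm]
    rw [hz, mul_zero, nonpos_iff_eq_zero] at h1
    exact (NSRenorm.ae_eq_zero_of_wnorm hd hp0 (hmaps ϑ hϑ).2.1.1 h1).trans hzero.symm
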